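/- Let $I,K$ be symmetric positive definite real $3\times3$ matrices, let $Q=SO(3)\times\mathbb S^1\times\mathbb S^1\times\mathbb S^1$, and identify $(\mathfrak{so}(3),[\,,])$ with $(\mathbb R^3,\times)$ and the Lie algebra of $\mathbb T^3=\mathbb S^1\times\mathbb S^1\times\mathbb S^1$ with $\mathbb R^3$. For $(R,\theta,\dot R,\dot\theta)\in TQ$ put $\Omega=R^{-1}\dot R$, $\Omega_r=\dot\theta$, $\eta=\Omega+\Omega_r$, and consider the Lagrangian of the free rigid body with three rotors $$L=\tfrac12\langle \Omega,I\Omega\rangle+\tfrac12\langle\Omega+\dot\theta,K(\Omega+\dot\theta)\rangle .$$ A Lagrange–Poincaré (LP) bundle is a bundle $TQ\oplus V\to Q$ with a Lie bracket in the fibres of the vector bundle $V$, a $V$-valued two-form $\omega$ on $Q$ and a linear connection $\nabla$ on $V$, such that $[X_1\oplus w_1,X_2\oplus w_2]=[X_1,X_2]\oplus(\nabla_{X_1}w_2-\nabla_{X_2}w_1-\omega(X_1,X_2)+[w_1,w_2])$ satisfies the Jacobi identity. The LP equations of a Lagrangian $\mathcal L(\dot q\oplus v)$ on it are $$\frac{\delta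 \mathcal L}{\delta q}-\frac{D}{Dt}\frac{\delta \mathcal L}{\delta\dot q}=\Big\langle\frac{\delta \mathcal L}{\delta v},\omega_q(\dot q,\cdot)\Big\rangle\ \text{(horizontal)},\qquad \frac{D}{Dt}\frac{\delta \mathcal L}{\delta v}=\mathrm{ad}^*_v\frac{\delta \mathcal L}{\delta v}\ \text{(vertical)},$$ where $\langle \mathrm{ad}^*_v\mu,u\rangle=\langle\mu,[v,u]\rangle$. If a group $G$ acts freely and properly by LP isomorphisms and $\mathcal A$ is a principal connection on $Q\to Q/G$ with curvature $B=d\mathcal A(\mathrm{Hor}\,\cdot,\mathrm{Hor}\,\cdot)$, the reduced LP bundle is $T(Q/G)\oplus\tilde{\mathfrak g}\oplus V/G$, with $$\nabla_X(\bar\xi\oplus[v])=\nabla^{\mathcal A}_X\bar\xi\oplus(\nabla^{H}_X[v]-[\omega](X,\bar\xi)),\qquad \omega(X_1,X_2)=\tilde B(X_1,X_2)\oplus[\omega](X_1,X_2),$$ $$[\bar\xi_1\oplus[v_1],\bar\xi_2\oplus[v_2]]=[\bar\xi_1,\bar\xi_2]\oplus(\nabla^{V}_{\bar\xi_1}[v_2]-\nabla^{V}_{\bar\xi_2}[v_1]-[\omega](\bar\xi_1,\bar\xi_2)+[v_1,v_2]),$$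 where $\nabla^H,\nabla^V$ are the horizontal and vertical quotient connections of $\nabla$, and an invariant Lagrangian induces the reduced Lagrangian through $\dot q\oplus v\mapsto T\pi(\dot q)\oplus[q,\mathcal A(\dot q)]\oplus[v]$. Then the following hold. 1. (First stage.) $A_{R,\theta}(\dot R,\dot\theta)=R^{-1}\dot R+\dot\theta$ is a principal connection on $Q\to SO(3)$ for the action of $\mathbb T^3$; it is the mechanical connection of the metric $\langle\langle(\dot R,\dot\theta),(\dot Q,\dot\phi)\rangle\rangle=\langle R^{-1}\dot Q,IR^{-1}\dot R\rangle+\langle R^{-1}\dot Q+\dot\phi,K(R^{-1}\dot R+\dot\theta)\rangle$, whose kinetic energy is $L$. The reduction of $(TQ,L)$ by $\mathbb T^3$ with $A$ is, after the trivialization $[R,\theta,\dot R,\dot\theta]\mapsto(R,\dot R,\eta)$, the LP bundle $TSO(3)\oplus(SO(3)\times\mathbb R^3)$ with zero fibre bracket, trivial connection and two-form $\tilde B_R(\dot R,\dot Q)=(R^{-1}\dot Q)\times(R^{-1}\dot R)$ (the curvature of $A$), with reduced Lagrangian $l_1(R,\dot R,\eta)=\frac12\langle R^{-1}\dot R,IR^{-1}\dot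 R\rangle+\frac12\langle\eta,K\eta\rangle$. For smooth curves $R(t)$, $\eta(t)$ its vertical LP equation is equivalent to $$K\dot\eta=0,$$ and its horizontal LP equation is equivalent to $$I\dot\Omega=I\Omega\times\Omega+(K\eta)\times\Omega .$$ 2. (Second stage.) $SO(3)$ acts on this system by $\Gamma\cdot(R,\dot R,\eta)=(\Gamma R,\Gamma\dot R,\eta)$. Its reduction with the principal connection $\dot RR^{-1}$ (which is $R^{-1}\dot R$ after trivializing the adjoint bundle) is, after the trivialization $[R,\dot R,\eta]\mapsto(\Omega,\eta)$, the LP bundle $\mathfrak{so}(3)\times\mathbb R^3\to\{\bullet\}$ over a point, with zero connection, zero two-form and bracket $[(\Omega_1,\eta_1),(\Omega_2,\eta_2)]=(\Omega_1\times\Omega_2)\oplus(\Omega_1\times\Omega_2)$, with reduced Lagrangian $l_2(\Omega,\eta)=\frac12\langle\Omega,I\Omega\rangle+\frac12\langle\eta,K\eta\rangle$. For smooth curves $\Omega(t),\eta(t)$ its horizontal LP equation is void; its vertical LP equation applied to the elements $(\alpha,0)$ is equivalent to $I\dot\Omega=I\Omega\times\Omega+(K\eta)\times\Omega$, applied to the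 elements $(0,\beta)$ it is equivalent to $K\dot\eta=0$, and so the whole vertical equation is equivalent to these two equations together. 3. (Equivalence with Euler–Poincaré.) Let $\ell(\Omega,\Omega_r)=\frac12\langle\Omega,(I+K)\Omega\rangle+\frac12\langle\Omega_r,K\Omega_r\rangle+\langle\Omega,K\Omega_r\rangle$, which is $L$ in the variables $(\Omega,\Omega_r)$. The Euler–Poincaré equation of $\ell$ on $\mathfrak{so}(3)\oplus\mathbb R^3$ with bracket $[(\alpha_1,\beta_1),(\alpha_2,\beta_2)]=(\alpha_1\times\alpha_2,0)$ is equivalent to $$(I+K)\dot\Omega+K\dot\Omega_r=((I+K)\Omega+K\Omega_r)\times\Omega,\qquad K\dot\Omega_r+K\dot\Omega=0,$$ and, with $\eta=\Omega+\Omega_r$, these two equations are equivalent to the two equations of item 2. 4. Consequently, for a smooth curve in $Q$ the following are equivalent: it solves the Euler–Lagrange equations of $L$ on $TQ$; $(R,\dot R,\eta)$ solves the LP equations of the first reduced system; $(\Omega,\eta)$ solves the LP equations of the second reduced system; $(\Omega,\Omega_r)$ solves the Euler–Poincaré equations. -/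

import Mathlib

open scoped Matrix ContDiff

attribute [local instance] Matrix.linftyOpNormedAddCommGroup Matrix.linftyOpNormedSpace
  Matrix.linftyOpNormedRing Matrix.linftyOpNormedAlgebra

noncomputable section

/-! ### Embedded manifolds

Manifolds are embedded in a finite-dimensional real vector space `E` and given as subsets of `E`.
Tensors on the manifold are written as functions on `E`; only their values at points of the
manifold and at tangent vectors matter. -/

section General

variable {E F E' F' 𝔸 𝔤 : Type*}
variable [NormedAddCommGroup E] [NormedSpace ℝ E] [NormedAddCommGroup F] [NormedSpace ℝ F]
variable [NormedAddCommGroup E'] [NormedSpace ℝ E'] [NormedAddCommGroup F'] [NormedSpace ℝ F']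
variable [NormedRing 𝔸] [NormedAlgebra ℝ 𝔸] [NormedAddCommGroup 𝔤] [NormedSpace ℝ 𝔤]

/-- The tangent space at `q`: velocities at `q` of smooth curves that stay in `M`. -/
def tangentAt (M : Set E) (q : E) : Set E :=
  {u | ∃ c : ℝ → E, ContDiff ℝ ∞ c ∧ (∀ t, c t ∈ M) ∧ c 0 = q ∧ HasDerivAt c u 0}

/-- A smooth curve in `M` with parameter in the open interval `J`. -/
def IsSmoothCurve (M : Set E) (J : Set ℝ) (c : ℝ → E) : Prop :=
  ContDiffOn ℝ ∞ c J ∧ ∀ t ∈ J, c t ∈ M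

/-- A Riemannian metric `m q u u'` on `M`. -/
structure IsRiemannianMetric (M : Set E) (m : E → E → E → ℝ) : Prop where
  smooth : ContDiff ℝ ∞ (fun p : E × E × E => m p.1 p.2.1 p.2.2)
  linear : ∀ q ∈ M, ∀ u, IsLinearMap ℝ (m q u)
  symm : ∀ q ∈ M, ∀ u u', m q u u' = m q u' u
  pos : ∀ q ∈ M, ∀ u ∈ tangentAt M q, u ≠ 0 → 0 < m q u u

/-! ### Lagrange-Poincaré bundles -/

/-- The data of a Lagrange-Poincaré bundle `TQ ⊕ V → Q` with `Q = base` and `V` the trivialised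
vector bundle `Q × F`: a bracket in the fibres of `V`, a `V`-valued two-form `form` on `Q`, and a
linear connection `∇_u w = dw(u) + conn q u w` on `V`. -/
structure LPBundle (E F : Type*) where
  base : Set E
  bracket : E → F → F → F
  form : E → E → E → F
  conn : E → E → F → F

namespace LPBundle

/-- The covariant derivative `Dw/dt` of a curve `(q(t), w(t))` in `V`. -/
def covDeriv (B : LPBundle E F) (q : ℝ → E) (w : ℝ → F) (t : ℝ) : F :=
  deriv w t + B.conn (q t) (deriv q t) (w t)

/-- A smooth section `X ⊕ w` of `TQ ⊕ V`. -/
def IsSection (B : LPBundle E F) (s : (E → E) × (E → F)) : Prop :=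
  ContDiff ℝ ∞ s.1 ∧ ContDiff ℝ ∞ s.2 ∧ ∀ q ∈ B.base, s.1 q ∈ tangentAt B.base q

/-- The bracket of sections
`[X₁ ⊕ w₁, X₂ ⊕ w₂] = [X₁, X₂] ⊕ (∇_{X₁} w₂ - ∇_{X₂} w₁ - ω(X₁, X₂) + [w₁, w₂])`. -/
def sectionBracket (B : LPBundle E F) (s₁ s₂ : (E → E) × (E → F)) : (E → E) × (E → F) :=
  (VectorField.lieBracket ℝ s₁.1 s₂.1,
    fun q => (fderiv ℝ s₂.2 q (s₁.1 q) + B.conn q (s₁.1 q) (s₂.2 q))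
      - (fderiv ℝ s₁.2 q (s₂.1 q) + B.conn q (s₂.1 q) (s₁.2 q))
      - B.form q (s₁.1 q) (s₂.1 q) + B.bracket q (s₁.2 q) (s₂.2 q))

/-- `B` is an object of the Lagrange-Poincaré category. -/
structure IsLP (B : LPBundle E F) : Prop where
  smooth_bracket : ContDiff ℝ ∞ (fun p : E × F × F => B.bracket p.1 p.2.1 p.2.2)
  smooth_form : ContDiff ℝ ∞ (fun p : E × E × E => B.form p.1 p.2.1 p.2.2)
  smooth_conn : ContDiff ℝ ∞ (fun p : E × E × F => B.conn p.1 p.2.1 p.2.2)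
  bracket_linear : ∀ q ∈ B.base, ∀ v, IsLinearMap ℝ (B.bracket q v)
  bracket_skew : ∀ q ∈ B.base, ∀ v w, B.bracket q v w = - B.bracket q w v
  bracket_jacobi : ∀ q ∈ B.base, ∀ v w x,
    B.bracket q v (B.bracket q w x) + B.bracket q w (B.bracket q x v)
      + B.bracket q x (B.bracket q v w) = 0
  form_linear : ∀ q ∈ B.base, ∀ u, IsLinearMap ℝ (B.form q u)
  form_skew : ∀ q ∈ B.base, ∀ u u', B.form q u u' = - B.form q u' u
  conn_linear_left : ∀ q ∈ B.base, ∀ w, IsLinearMap ℝ (fun u => B.conn q u w)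
  conn_linear_right : ∀ q ∈ B.base, ∀ u, IsLinearMap ℝ (B.conn q u)
  jacobi : ∀ s₁ s₂ s₃, B.IsSection s₁ → B.IsSection s₂ → B.IsSection s₃ → ∀ q ∈ B.base,
    (B.sectionBracket s₁ (B.sectionBracket s₂ s₃)).1 q
      + (B.sectionBracket s₂ (B.sectionBracket s₃ s₁)).1 q
      + (B.sectionBracket s₃ (B.sectionBracket s₁ s₂)).1 q = 0 ∧
    (B.sectionBracket s₁ (B.sectionBracket s₂ s₃)).2 q
      + (B.sectionBracket s₂ (B.sectionBracket s₃ s₁)).2 q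
      + (B.sectionBracket s₃ (B.sectionBracket s₁ s₂)).2 q = 0

end LPBundle

/-! ### Lagrange-Poincaré equations

A Lagrangian on `TQ ⊕ V` is a function `L q u v` of a point, a tangent vector and an element of
the fibre. -/

/-- The fibre derivative `⟨∂L/∂q̇ (q, u, v), u'⟩`. -/
def velDeriv (L : E → E → F → ℝ) (q u : E) (v : F) (u' : E) : ℝ :=
  deriv (fun s : ℝ => L q (u + s • u') v) 0

/-- The fibre derivative `⟨∂L/∂v (q, u, v), w⟩`. -/
def fibDeriv (L : E → E → F → ℝ) (q u : E) (v w : F) : ℝ :=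
  deriv (fun s : ℝ => L q u (v + s • w)) 0

/-- `c t ε` is a smooth variation in `M` of the curve `q` on `J`. -/
structure IsVariation (M : Set E) (J : Set ℝ) (q : ℝ → E) (c : ℝ → ℝ → E) : Prop where
  smooth : ContDiffOn ℝ ∞ (fun p : ℝ × ℝ => c p.1 p.2) (J ×ˢ Set.univ)
  mem : ∀ t ∈ J, ∀ ε, c t ε ∈ M
  init : ∀ t ∈ J, c t 0 = q t

/-- The infinitesimal variation `δq(t)`. -/
def infVar (c : ℝ → ℝ → E) (t : ℝ) : E := deriv (fun ε => c t ε) 0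

/-- The covector `δL/δq - D/Dt δL/δq̇` along `(q, v)` at time `t`, paired with `δq(t)`.
Here `δL/δq` is the derivative along the horizontal lift, so the fibre variable is moved with
vanishing covariant derivative `Dv/Dε` at `ε = 0`. For every torsion-free connection on `Q`,
`⟨δL/δq, δq⟩ = d/dε L - ⟨∂L/∂q̇, D δq/Dt⟩` and
`⟨D/Dt ∂L/∂q̇, δq⟩ = d/dt ⟨∂L/∂q̇, δq⟩ - ⟨∂L/∂q̇, D δq/Dt⟩`; the last terms cancel. -/
def eulerOperator (B : LPBundle E F) (L : E → E → F → ℝ) (q : ℝ → E) (v : ℝ → F)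
    (c : ℝ → ℝ → E) (t : ℝ) : ℝ :=
  deriv (fun ε : ℝ => L (c t ε) (deriv (fun s => c s ε) t)
      (v t - ε • B.conn (q t) (infVar c t) (v t))) 0
    - deriv (fun s => velDeriv L (q s) (deriv q s) (v s) (infVar c s)) t

/-- The horizontal Lagrange-Poincaré equation
`δL/δq - D/Dt δL/δq̇ = ⟨δL/δv, ω(q̇, ·)⟩` on `J`. -/
def HorizontalLP (B : LPBundle E F) (L : E → E → F → ℝ) (J : Set ℝ) (q : ℝ → E) (v : ℝ → F) :
    Prop :=
  ∀ c : ℝ → ℝ → E, IsVariation B.base J q c → ∀ t ∈ J,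
    eulerOperator B L q v c t
      = fibDeriv L (q t) (deriv q t) (v t) (B.form (q t) (deriv q t) (infVar c t))

/-- The vertical Lagrange-Poincaré equation `D/Dt δL/δv = ad*_v δL/δv` at time `t`, applied to the
element `w` of the fibre. On the dual bundle `⟨Dμ/Dt, w⟩ = d/dt ⟨μ, w⟩ - ⟨μ, Dw/dt⟩`, and
`⟨ad*_v μ, w⟩ = ⟨μ, [v, w]⟩`. -/
def VerticalLPAt (B : LPBundle E F) (L : E → E → F → ℝ) (q : ℝ → E) (v : ℝ → F) (t : ℝ) (w : F) :
    Prop :=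
  deriv (fun s => fibDeriv L (q s) (deriv q s) (v s) w) t
      - fibDeriv L (q t) (deriv q t) (v t) (B.covDeriv q (fun _ => w) t)
    = fibDeriv L (q t) (deriv q t) (v t) (B.bracket (q t) (v t) w)

/-- The vertical Lagrange-Poincaré equation on `J`. -/
def VerticalLP (B : LPBundle E F) (L : E → E → F → ℝ) (J : Set ℝ) (q : ℝ → E) (v : ℝ → F) :
    Prop :=
  ∀ t ∈ J, ∀ w : F, VerticalLPAt B L q v t w

/-- The curve `q̇ ⊕ v` solves the Lagrange-Poincaré equations of `L` on `J`. -/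
def SolvesLP (B : LPBundle E F) (L : E → E → F → ℝ) (J : Set ℝ) (q : ℝ → E) (v : ℝ → F) : Prop :=
  HorizontalLP B L J q v ∧ VerticalLP B L J q v

/-! ### Symmetry, principal connections and reduction -/

/-- A linear Lie group `group ⊆ 𝔸`, its Lie algebra `𝔤` embedded in `𝔸` by `incl`, an action of
the group on `E` and, over it, an action `fibreAct g q : V_q → V_{gq}`. -/
structure SymmetryData (𝔸 𝔤 E F : Type*) [NormedRing 𝔸] where
  group : Submonoid 𝔸
  incl : 𝔤 → 𝔸
  lie : 𝔤 → 𝔤 → 𝔤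
  act : 𝔸 → E → E
  fibreAct : 𝔸 → E → F → F

namespace SymmetryData

/-- The infinitesimal generator `ξ^Q_q = d/dt exp(tξ) q` at `t = 0`. -/
def gen (S : SymmetryData 𝔸 𝔤 E F) (ξ : 𝔤) (q : E) : E :=
  deriv (fun t : ℝ => S.act (NormedSpace.exp (t • S.incl ξ)) q) 0

/-- The action on tangent vectors. -/
def tangentAct (S : SymmetryData 𝔸 𝔤 E F) (g : 𝔸) (q u : E) : E := fderiv ℝ (S.act g) q u

/-- `group` is a closed linear Lie group and `(𝔤, lie)` is its Lie algebra. -/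
structure IsLieGroup (S : SymmetryData 𝔸 𝔤 E F) : Prop where
  closed : IsClosed (S.group : Set 𝔸)
  inverse : ∀ g ∈ S.group, ∃ h ∈ S.group, g * h = 1 ∧ h * g = 1
  incl_linear : IsLinearMap ℝ S.incl
  incl_injective : Function.Injective S.incl
  incl_range : Set.range S.incl = {a | ∀ t : ℝ, NormedSpace.exp (t • a) ∈ S.group}
  incl_lie : ∀ ξ ζ, S.incl (S.lie ξ ζ) = S.incl ξ * S.incl ζ - S.incl ζ * S.incl ξ

/-- The group acts freely and properly on `TQ ⊕ V` by isomorphisms of Lagrange-Poincaré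
bundles. -/
structure IsLPAction (S : SymmetryData 𝔸 𝔤 E F) (B : LPBundle E F) : Prop where
  smooth_act : ContDiff ℝ ∞ (fun p : 𝔸 × E => S.act p.1 p.2)
  smooth_fibreAct : ContDiff ℝ ∞ (fun p : 𝔸 × E × F => S.fibreAct p.1 p.2.1 p.2.2)
  mem : ∀ g ∈ S.group, ∀ q ∈ B.base, S.act g q ∈ B.base
  act_one : ∀ q ∈ B.base, S.act 1 q = q
  act_mul : ∀ g ∈ S.group, ∀ h ∈ S.group, ∀ q ∈ B.base, S.act (g * h) q = S.act g (S.act h q)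
  fibreAct_one : ∀ q ∈ B.base, ∀ v, S.fibreAct 1 q v = v
  fibreAct_mul : ∀ g ∈ S.group, ∀ h ∈ S.group, ∀ q ∈ B.base, ∀ v,
    S.fibreAct (g * h) q v = S.fibreAct g (S.act h q) (S.fibreAct h q v)
  fibreAct_linear : ∀ g ∈ S.group, ∀ q ∈ B.base, IsLinearMap ℝ (S.fibreAct g q)
  free : ∀ g ∈ S.group, ∀ q ∈ B.base, S.act g q = q → g = 1
  proper : ∀ C ⊆ B.base, IsCompact C → IsCompact {g | g ∈ S.group ∧ ∃ q ∈ C, S.act g q ∈ C}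
  bracket : ∀ g ∈ S.group, ∀ q ∈ B.base, ∀ v w, S.fibreAct g q (B.bracket q v w)
    = B.bracket (S.act g q) (S.fibreAct g q v) (S.fibreAct g q w)
  form : ∀ g ∈ S.group, ∀ q ∈ B.base, ∀ u ∈ tangentAt B.base q, ∀ u' ∈ tangentAt B.base q,
    S.fibreAct g q (B.form q u u')
      = B.form (S.act g q) (S.tangentAct g q u) (S.tangentAct g q u')
  conn : ∀ g ∈ S.group, ∀ (q : ℝ → E) (w : ℝ → F), IsSmoothCurve B.base Set.univ q →
    ContDiff ℝ ∞ w → ∀ t, S.fibreAct g (q t) (B.covDeriv q w t)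
      = B.covDeriv (fun s => S.act g (q s)) (fun s => S.fibreAct g (q s) (w s)) t

/-- `A` is a principal connection for the action on `M`:
`A(ξ^Q) = ξ` and `A_{gq}(g u) = Ad_g (A_q u)`. -/
structure IsPrincipalConnection (S : SymmetryData 𝔸 𝔤 E F) (M : Set E) (A : E → E → 𝔤) :
    Prop where
  smooth : ContDiff ℝ ∞ (fun p : E × E => A p.1 p.2)
  linear : ∀ q, IsLinearMap ℝ (A q)
  gen : ∀ q ∈ M, ∀ ξ, A q (S.gen ξ q) = ξ
  equivariant : ∀ g ∈ S.group, ∀ q ∈ M, ∀ u ∈ tangentAt M q,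
    S.incl (A (S.act g q) (S.tangentAct g q u)) * g = g * S.incl (A q u)

/-- `A` is the mechanical connection of the metric `m`: `m` is an invariant Riemannian metric and
the horizontal space `ker A_q` is the orthogonal complement of the vertical space. -/
structure IsMechanical (S : SymmetryData 𝔸 𝔤 E F) (M : Set E) (m : E → E → E → ℝ)
    (A : E → E → 𝔤) : Prop where
  metric : IsRiemannianMetric M m
  invariant : ∀ g ∈ S.group, ∀ q ∈ M, ∀ u ∈ tangentAt M q, ∀ u' ∈ tangentAt M q,
    m (S.act g q) (S.tangentAct g q u) (S.tangentAct g q u') = m q u u'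
  orthogonal : ∀ q ∈ M, ∀ u ∈ tangentAt M q, A q u = 0 ↔ ∀ ξ, m q u (S.gen ξ q) = 0

/-- The horizontal projection of a tangent vector. -/
def hor (S : SymmetryData 𝔸 𝔤 E F) (A : E → E → 𝔤) (q u : E) : E := u - S.gen (A q u) q

/-- The curvature `B(u, u') = dA(Hor u, Hor u')`. -/
def curvature (S : SymmetryData 𝔸 𝔤 E F) (A : E → E → 𝔤) (q u u' : E) : 𝔤 :=
  fderiv ℝ (fun x => A x (S.hor A q u')) q (S.hor A q u)
    - fderiv ℝ (fun x => A x (S.hor A q u)) q (S.hor A q u')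

/-- The vertical quotient derivative: `∇` along the vertical vector `ξ^Q_q` of the invariant
section through `v ∈ V_q`. -/
def vertDeriv (S : SymmetryData 𝔸 𝔤 E F) (B : LPBundle E F) (ξ : 𝔤) (q : E) (v : F) : F :=
  B.covDeriv (fun t => S.act (NormedSpace.exp (t • S.incl ξ)) q)
    (fun t => S.fibreAct (NormedSpace.exp (t • S.incl ξ)) q v) 0

/-- The smooth map `π` realises `M → M'` as the quotient of `M` by the group: it is a surjective
submersion whose fibres are the orbits. -/
structure IsQuotientMap (S : SymmetryData 𝔸 𝔤 E F) (M : Set E) (M' : Set E') (π : E → E') :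
    Prop where
  smooth : ContDiff ℝ ∞ π
  image : π '' M = M'
  fibre : ∀ q₁ ∈ M, ∀ q₂ ∈ M, π q₁ = π q₂ ↔ ∃ g ∈ S.group, S.act g q₁ = q₂
  submersion : ∀ q ∈ M, fderiv ℝ π q '' tangentAt M q = tangentAt M' (π q)

/-- `triv q ξ v` trivialises the quotient bundle `𝔤̃ ⊕ V/G` over `M/G` as `M/G × F'`: it is a linear
isomorphism `𝔤 × V_q ≃ F'` with `triv (g q) (Ad_g ξ) (g v) = triv q ξ v`, so that it descends to
the classes `[q, ξ]_G ⊕ [v]_G`. -/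
structure IsTrivialization (S : SymmetryData 𝔸 𝔤 E F) (M : Set E) (triv : E → 𝔤 → F → F') :
    Prop where
  smooth : ContDiff ℝ ∞ (fun p : E × 𝔤 × F => triv p.1 p.2.1 p.2.2)
  linear : ∀ q ∈ M, IsLinearMap ℝ (fun p : 𝔤 × F => triv q p.1 p.2)
  bijective : ∀ q ∈ M, Function.Bijective (fun p : 𝔤 × F => triv q p.1 p.2)
  invariant : ∀ g ∈ S.group, ∀ q ∈ M, ∀ ξ ξ' : 𝔤, S.incl ξ' * g = g * S.incl ξ → ∀ v,
    triv (S.act g q) ξ' (S.fibreAct g q v) = triv q ξ v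

/-- The map `TQ ⊕ V → T(Q/G) ⊕ 𝔤̃ ⊕ V/G`, `u ⊕ v ↦ dπ(u) ⊕ [q, A(u)]_G ⊕ [v]_G`, composed with the
trivialisation; the base point is the first component. -/
def identification (A : E → E → 𝔤) (π : E → E') (triv : E → 𝔤 → F → F') (q u : E) (v : F) :
    E' × E' × F' :=
  (π q, fderiv ℝ π q u, triv q (A q u) v)

/-- The identification descends to a bijection from `(TQ ⊕ V)/G` onto `TQ' ⊕ (Q' × F')`. -/
structure IsIdentification (S : SymmetryData 𝔸 𝔤 E F) (B : LPBundle E F) (M' : Set E')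
    (A : E → E → 𝔤) (π : E → E') (triv : E → 𝔤 → F → F') : Prop where
  orbits : ∀ q₁ ∈ B.base, ∀ u₁ ∈ tangentAt B.base q₁, ∀ v₁,
    ∀ q₂ ∈ B.base, ∀ u₂ ∈ tangentAt B.base q₂, ∀ v₂,
    identification A π triv q₁ u₁ v₁ = identification A π triv q₂ u₂ v₂ ↔
      ∃ g ∈ S.group, S.act g q₁ = q₂ ∧ S.tangentAct g q₁ u₁ = u₂ ∧ S.fibreAct g q₁ v₁ = v₂
  surjective : ∀ x ∈ M', ∀ X ∈ tangentAt M' x, ∀ y : F', ∃ q ∈ B.base,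
    ∃ u ∈ tangentAt B.base q, ∃ v, identification A π triv q u v = (x, X, y)

/-- `B'` is the reduced Lagrange-Poincaré bundle of `B` with respect to the group and the
connection `A`, in the trivialisation `triv`. In terms of representatives:
* the two-form is `B̃(X₁, X₂) ⊕ [ω](X₁, X₂)`;
* the bracket is `[ξ₁, ξ₂] ⊕ (∇^V_{ξ₁} v₂ - ∇^V_{ξ₂} v₁ - ω(ξ₁^Q, ξ₂^Q) + [v₁, v₂])`;
* the covariant derivative along a curve is
  `D[q, ξ]/Dt ⊕ (∇^H [v] - [ω](ẋ, [q, ξ]))`, where `D[q, ξ]/Dt = [q, ξ̇ - [A(q̇), ξ]]`, and the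
  horizontal quotient derivative of `[v]` is the full derivative minus its vertical part. -/
structure IsReducedBundle (S : SymmetryData 𝔸 𝔤 E F) (B : LPBundle E F) (A : E → E → 𝔤)
    (π : E → E') (triv : E → 𝔤 → F → F') (B' : LPBundle E' F') : Prop where
  form : ∀ q ∈ B.base, ∀ u ∈ tangentAt B.base q, ∀ u' ∈ tangentAt B.base q,
    B'.form (π q) (fderiv ℝ π q u) (fderiv ℝ π q u')
      = triv q (S.curvature A q u u') (B.form q (S.hor A q u) (S.hor A q u'))
  bracket : ∀ q ∈ B.base, ∀ ξ₁ ξ₂ v₁ v₂,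
    B'.bracket (π q) (triv q ξ₁ v₁) (triv q ξ₂ v₂)
      = triv q (S.lie ξ₁ ξ₂) (S.vertDeriv B ξ₁ q v₂ - S.vertDeriv B ξ₂ q v₁
          - B.form q (S.gen ξ₁ q) (S.gen ξ₂ q) + B.bracket q v₁ v₂)
  conn : ∀ (q : ℝ → E) (ξ : ℝ → 𝔤) (v : ℝ → F), IsSmoothCurve B.base Set.univ q →
    ContDiff ℝ ∞ ξ → ContDiff ℝ ∞ v → ∀ t,
    B'.covDeriv (fun s => π (q s)) (fun s => triv (q s) (ξ s) (v s)) t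
      = triv (q t) (deriv ξ t - S.lie (A (q t) (deriv q t)) (ξ t))
          (B.covDeriv q v t - S.vertDeriv B (A (q t) (deriv q t)) (q t) (v t)
            - B.form (q t) (S.hor A (q t) (deriv q t)) (S.gen (ξ t) (q t)))

/-- `L` is invariant and `l` is the function induced by `L` on the quotient. -/
structure IsReducedLagrangian (S : SymmetryData 𝔸 𝔤 E F) (B : LPBundle E F) (A : E → E → 𝔤)
    (π : E → E') (triv : E → 𝔤 → F → F') (L : E → E → F → ℝ) (l : E' → E' → F' → ℝ) : Prop where
  invariant : ∀ g ∈ S.group, ∀ q ∈ B.base, ∀ u ∈ tangentAt B.base q, ∀ v,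
    L (S.act g q) (S.tangentAct g q u) (S.fibreAct g q v) = L q u v
  reduced : ∀ q ∈ B.base, ∀ u ∈ tangentAt B.base q, ∀ v,
    l (π q) (fderiv ℝ π q u) (triv q (A q u) v) = L q u v

/-- One step of Lagrange-Poincaré reduction: the system `(B, L)` is reduced by the group of `S`,
with the principal connection `A`, to the system `(B', l)`. -/
structure IsReductionStep (S : SymmetryData 𝔸 𝔤 E F) (B : LPBundle E F) (L : E → E → F → ℝ)
    (A : E → E → 𝔤) (π : E → E') (triv : E → 𝔤 → F → F') (B' : LPBundle E' F')
    (l : E' → E' → F' → ℝ) : Prop where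
  lieGroup : S.IsLieGroup
  source : B.IsLP
  action : S.IsLPAction B
  quotient : S.IsQuotientMap B.base B'.base π
  connection : S.IsPrincipalConnection B.base A
  trivialization : S.IsTrivialization B.base triv
  ident : S.IsIdentification B B'.base A π triv
  bundle : S.IsReducedBundle B A π triv B'
  target : B'.IsLP
  lagrangian : S.IsReducedLagrangian B A π triv L l

end SymmetryData

end General

/-! ### The rigid body with three rotors -/

/-- `ℝ³`, also identified with `𝔰𝔬(3)` (with the cross product) by `hat`. -/
abbrev V3 := Fin 3 → ℝ

abbrev M3 := Matrix (Fin 3) (Fin 3) ℝ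

/-- The skew matrix of `x`, with `hat x *ᵥ y = x ⨯₃ y`. -/
def hat (x : V3) : M3 := !![0, -x 2, x 1; x 2, 0, -x 0; -x 1, x 0, 0]

/-- The inverse of `hat` on skew matrices. -/
def vee (a : M3) : V3 := ![a 2 1, a 0 2, a 1 0]

def SO3 : Set M3 := {R | R ∈ Matrix.specialOrthogonalGroup (Fin 3) ℝ}

/-- `𝕊¹ × 𝕊¹ × 𝕊¹`, with `𝕊¹` the unit circle of `ℂ`. -/
def T3 : Set (Fin 3 → ℂ) := {z | ∀ i, ‖z i‖ = 1}

/-- The body angular velocity `Ω = R⁻¹ Ṙ`; note `R⁻¹ = Rᵀ` on `SO(3)`. -/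
def bodyVel (R R' : M3) : V3 := vee (Rᵀ * R')

/-- The rotor angular velocity `Ω_r = θ̇`: if `z = exp(i θ)` then `ż = i θ̇ z`. -/
def rotorVel (z z' : Fin 3 → ℂ) : V3 := fun i => (star (z i) * z' i).im

/-- `TQ` with `Q = SO(3) × 𝕊¹ × 𝕊¹ × 𝕊¹`, as a Lagrange-Poincaré bundle with `V = 0`. -/
def rotorBundle : LPBundle (M3 × (Fin 3 → ℂ)) PUnit.{1} where
  base := SO3 ×ˢ T3
  bracket _ _ _ := 0
  form _ _ _ := 0
  conn _ _ _ := 0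

/-- The Lagrangian `½⟨Ω, IΩ⟩ + ½⟨Ω + θ̇, K(Ω + θ̇)⟩` on `TQ`. -/
def rotorLagrangian (I K : M3) (q u : M3 × (Fin 3 → ℂ)) (_ : PUnit.{1}) : ℝ :=
  (1 / 2) * (bodyVel q.1 u.1 ⬝ᵥ (I *ᵥ bodyVel q.1 u.1))
    + (1 / 2) * ((bodyVel q.1 u.1 + rotorVel q.2 u.2)
        ⬝ᵥ (K *ᵥ (bodyVel q.1 u.1 + rotorVel q.2 u.2)))

/-- The metric on `Q` whose kinetic energy is the Lagrangian. -/
def rotorMetric (I K : M3) (q u w : M3 × (Fin 3 → ℂ)) : ℝ :=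
  bodyVel q.1 w.1 ⬝ᵥ (I *ᵥ bodyVel q.1 u.1)
    + (bodyVel q.1 w.1 + rotorVel q.2 w.2) ⬝ᵥ (K *ᵥ (bodyVel q.1 u.1 + rotorVel q.2 u.2))

/-- The action of `𝕊¹ × 𝕊¹ × 𝕊¹` on `TQ`; its Lie algebra `i ℝ³` is identified with `ℝ³`. -/
def torusSymmetry :
    SymmetryData (Fin 3 → ℂ) V3 (M3 × (Fin 3 → ℂ)) PUnit.{1} where
  group := unitary (Fin 3 → ℂ)
  incl a := fun i => (a i : ℂ) * Complex.I
  lie _ _ := 0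
  act z q := (q.1, z * q.2)
  fibreAct _ _ v := v

/-- The connection `A = R⁻¹ Ṙ + θ̇` of `SO(3) × 𝕊¹ × 𝕊¹ × 𝕊¹ → SO(3)`. -/
def torusConnection (q u : M3 × (Fin 3 → ℂ)) : V3 := bodyVel q.1 u.1 + rotorVel q.2 u.2

/-- The trivialisation `[R, θ, η] ↦ (R, η)` of the adjoint bundle over `SO(3)`. -/
def torusTriv (_ : M3 × (Fin 3 → ℂ)) (η : V3) (_ : PUnit.{1}) : V3 := η

/-- The bundle `TSO(3) ⊕ (SO(3) × ℝ³)` with trivial bracket, trivial covariant derivative and the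
two-form `(R⁻¹ Q̇) × (R⁻¹ Ṙ)`. -/
def bodyBundle : LPBundle M3 V3 where
  base := SO3
  bracket _ _ _ := 0
  form R R' Q' := bodyVel R Q' ⨯₃ bodyVel R R'
  conn _ _ _ := 0

/-- The first reduced Lagrangian `½⟨R⁻¹Ṙ, I R⁻¹Ṙ⟩ + ½⟨η, Kη⟩`. -/
def bodyLagrangian (I K : M3) (R R' : M3) (η : V3) : ℝ :=
  (1 / 2) * (bodyVel R R' ⬝ᵥ (I *ᵥ bodyVel R R')) + (1 / 2) * (η ⬝ᵥ (K *ᵥ η))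

/-- The action `Γ (R, Ṙ, η) = (Γ R, Γ Ṙ, η)` of `SO(3)`, with `𝔰𝔬(3)` identified with `ℝ³`. -/
def rotationSymmetry : SymmetryData M3 V3 M3 V3 where
  group := Matrix.specialOrthogonalGroup (Fin 3) ℝ
  incl := hat
  lie x y := x ⨯₃ y
  act Γ R := Γ * R
  fibreAct _ _ η := η

/-- The principal connection of `SO(3) → {•}`, namely `Ad_R (R⁻¹ Ṙ) = Ṙ R⁻¹`. In the
trivialisation `rotationTriv` of the adjoint bundle it reads `R⁻¹ Ṙ`. -/
def rotationConnection (R R' : M3) : V3 := vee (R' * Rᵀ)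

/-- The trivialisation `[R, ξ] ⊕ [R, η] ↦ (R⁻¹ ξ R, η)`; in `ℝ³`, `Ad_{R⁻¹} ξ` is `R⁻¹ ξ`. -/
def rotationTriv (R : M3) (ξ η : V3) : V3 × V3 := (Rᵀ *ᵥ ξ, η)

/-- The bundle `𝔰𝔬(3) × ℝ³ → {•}` with bracket `(Ω₁ × Ω₂) ⊕ (Ω₁ × Ω₂)`. -/
def pointBundle : LPBundle PUnit.{1} (V3 × V3) where
  base := Set.univ
  bracket _ a b := (a.1 ⨯₃ b.1, a.1 ⨯₃ b.1)
  form _ _ _ := 0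
  conn _ _ _ := 0

/-- The second reduced Lagrangian `½⟨Ω, IΩ⟩ + ½⟨η, Kη⟩`. -/
def pointLagrangian (I K : M3) (_ _ : PUnit.{1}) (a : V3 × V3) : ℝ :=
  (1 / 2) * (a.1 ⬝ᵥ (I *ᵥ a.1)) + (1 / 2) * (a.2 ⬝ᵥ (K *ᵥ a.2))

/-- The Lie algebra `𝔰𝔬(3) ⊕ ℝ³` of `SO(3) × 𝕊¹ × 𝕊¹ × 𝕊¹`, with bracket `(α₁ × α₂) ⊕ 0`, as a
bundle over a point: its vertical equation is the Euler-Poincaré equation. -/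
def epBundle : LPBundle PUnit.{1} (V3 × V3) where
  base := Set.univ
  bracket _ a b := (a.1 ⨯₃ b.1, 0)
  form _ _ _ := 0
  conn _ _ _ := 0

/-- The Euler-Poincaré Lagrangian `½⟨Ω, (I+K)Ω⟩ + ½⟨Ω_r, KΩ_r⟩ + ⟨Ω, KΩ_r⟩`. -/
def epLagrangian (I K : M3) (_ _ : PUnit.{1}) (a : V3 × V3) : ℝ :=
  (1 / 2) * (a.1 ⬝ᵥ ((I + K) *ᵥ a.1)) + (1 / 2) * (a.2 ⬝ᵥ (K *ᵥ a.2)) + a.1 ⬝ᵥ (K *ᵥ a.2)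

end

/-! ### The hat map and the rotation group -/

/-! Everything rests on left trivialization. A tangent vector of SO(3) at `R` is `R * hat x`, and
one of the torus at `z` is `imag a * z` (`mem_tangentAt_SO3`, `mem_tangentAt_prod`), so connections,
metrics and Lagrangians become expressions in `x` and `a` alone. The body velocity is bilinear on
the ambient matrix space, so differentiating it in the base point merely replaces that point by a
tangent vector. What survives antisymmetrization is a commutator, that is, the cross product:
`bodyVel_mul_hat_sub`, the Maurer–Cartan equation.

This identity has three consequences. It gives the curvature of the torus connection
(`torus_curvature`). It gives the closedness of the resulting two-form, which is the Jacobi identity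
of the first reduced bundle (`bodyBundle_isLP`). It gives the constrained variation `δΩ = σ' + Ω ×
σ` (`hasDerivAt_bodyVel_variation`). On the torus the corresponding term vanishes, since products of
imaginary numbers are real.

In the second stage SO(3) is transitive on the base, so every vector is vertical, and `-ω` of two
generators becomes the second component of the bracket (`rotation_isReducedBundle`).

For the dynamics, each system is brought to the same pair `IΩ' = IΩ × Ω + Kη × Ω`, `Kη' = 0`
(`solvesLP_rotor_iff`, `horizontalLP_body_iff`, `verticalLP_body_iff`, `verticalLPAt_point_iff`).
Variations `R exp(ε ŷ)` realize every direction, so testing against them recovers vector equations.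
The Euler–Poincaré pair differs only by adding `Kη' = 0` to the first equation
(`reduced_iff_eulerPoincare`). -/

lemma vee_hat (x : V3) : vee (hat x) = x := by
  ext i; fin_cases i <;> simp [vee, hat]

lemma hat_vee {a : M3} (h : aᵀ = -a) : hat (vee a) = a := by
  have e : ∀ i j, a j i = - a i j := fun i j => congrFun (congrFun h i) j
  have d : ∀ i, a i i = 0 := fun i => by linarith [e i i]
  ext i j
  fin_cases i <;> fin_cases j <;> simp [vee, hat, d] <;>
    first | linarith [e 0 1] | linarith [e 0 2] | linarith [e 1 2]

lemma hat_transpose (x : V3) : (hat x)ᵀ = -hat x := by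
  ext i j; fin_cases i <;> fin_cases j <;> simp [hat]

lemma hat_mul_hat_sub (x y : V3) : hat (x ⨯₃ y) = hat x * hat y - hat y * hat x := by
  ext i j
  fin_cases i <;> fin_cases j <;>
    simp [hat, cross_apply] <;> ring

lemma hat_add (x y : V3) : hat (x + y) = hat x + hat y := by
  ext i j; fin_cases i <;> fin_cases j <;> simp [hat] <;> ring

lemma hat_smul (c : ℝ) (x : V3) : hat (c • x) = c • hat x := by
  ext i j; fin_cases i <;> fin_cases j <;> simp [hat]

lemma hat_injective : Function.Injective hat := fun x y h => by
  rw [← vee_hat x, h, vee_hat]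

lemma vee_add (a b : M3) : vee (a + b) = vee a + vee b := by
  ext i; fin_cases i <;> simp [vee]

lemma vee_sub (a b : M3) : vee (a - b) = vee a - vee b := by
  ext i; fin_cases i <;> simp [vee]

lemma vee_smul (c : ℝ) (a : M3) : vee (c • a) = c • vee a := by
  ext i; fin_cases i <;> simp [vee]

/-- Paired with vectors `y` and `z`, the left side is the triple product of `R y`, `R x`, `R z`,
which is `det R` times that of `y`, `x`, `z`. Hence no orthogonality is needed here. -/
lemma transpose_mul_hat_mul (R : M3) (x : V3) : Rᵀ * hat (R *ᵥ x) * R = R.det • hat x := by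
  ext i j
  fin_cases i <;> fin_cases j <;>
    simp [hat, Matrix.mul_apply, Fin.sum_univ_succ, Matrix.mulVec, dotProduct,
      Matrix.det_fin_three] <;> ring

lemma mem_SO3_iff {R : M3} : R ∈ SO3 ↔ Rᵀ * R = 1 ∧ R.det = 1 := by
  change R ∈ Matrix.specialOrthogonalGroup (Fin 3) ℝ ↔ _
  rw [Matrix.mem_specialOrthogonalGroup_iff, Matrix.mem_orthogonalGroup_iff']

lemma SO3_transpose_mul {R : M3} (h : R ∈ SO3) : Rᵀ * R = 1 := (mem_SO3_iff.1 h).1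

lemma SO3_mul_transpose {R : M3} (h : R ∈ SO3) : R * Rᵀ = 1 :=
  mul_eq_one_comm.1 (SO3_transpose_mul h)

lemma SO3_mul {R S : M3} (hR : R ∈ SO3) (hS : S ∈ SO3) : R * S ∈ SO3 :=
  (Matrix.specialOrthogonalGroup (Fin 3) ℝ).mul_mem hR hS

lemma SO3_transpose {R : M3} (h : R ∈ SO3) : Rᵀ ∈ SO3 :=
  mem_SO3_iff.2 ⟨by rw [Matrix.transpose_transpose]; exact SO3_mul_transpose h,
    by rw [Matrix.det_transpose]; exact (mem_SO3_iff.1 h).2⟩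

lemma one_mem_SO3 : (1 : M3) ∈ SO3 := (Matrix.specialOrthogonalGroup (Fin 3) ℝ).one_mem

lemma SO3_hat_mulVec_mul {R : M3} (h : R ∈ SO3) (x : V3) : hat (R *ᵥ x) * R = R * hat x := by
  have := congrArg (R * ·) (transpose_mul_hat_mul R x)
  simpa [(mem_SO3_iff.1 h).2, ← mul_assoc, SO3_mul_transpose h] using this

/-- Under `hat`, rotating a vector is conjugation by `R`, an algebra automorphism; it therefore
respects commutators, which are cross products. -/
lemma SO3_mulVec_cross {R : M3} (h : R ∈ SO3) (x y : V3) :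
    R *ᵥ (x ⨯₃ y) = (R *ᵥ x) ⨯₃ (R *ᵥ y) := by
  apply hat_injective
  have hR := SO3_mul_transpose h
  have key : ∀ z, hat (R *ᵥ z) = R * hat z * Rᵀ := fun z => by
    rw [← SO3_hat_mulVec_mul h, mul_assoc, hR, mul_one]
  rw [hat_mul_hat_sub, key, key, key, hat_mul_hat_sub]
  have e : ∀ a b : M3, R * a * Rᵀ * (R * b * Rᵀ) = R * (a * b) * Rᵀ := fun a b => by
    calc _ = R * a * (Rᵀ * R) * b * Rᵀ := by noncomm_ring
      _ = _ := by rw [SO3_transpose_mul h]; noncomm_ring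
  rw [e, e]; noncomm_ring

lemma bodyVel_mul_hat {R : M3} (h : R ∈ SO3) (x : V3) : bodyVel R (R * hat x) = x := by
  rw [bodyVel, ← mul_assoc, SO3_transpose_mul h, one_mul, vee_hat]

lemma bodyVel_mul_left {g : M3} (h : g ∈ SO3) (R S : M3) :
    bodyVel (g * R) (g * S) = bodyVel R S := by
  rw [bodyVel, bodyVel, Matrix.transpose_mul]
  congr 1
  calc _ = Rᵀ * (gᵀ * g) * S := by noncomm_ring
    _ = _ := by rw [SO3_transpose_mul h, mul_one]

/-- The Maurer–Cartan equation. Transposing `R * hat y` produces `-hat y`, so the antisymmetrized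
derivative of `Rᵀ dR` is a commutator of skew matrices. -/
lemma bodyVel_mul_hat_sub {R : M3} (h : R ∈ SO3) (x y : V3) :
    bodyVel (R * hat y) (R * hat x) - bodyVel (R * hat x) (R * hat y) = x ⨯₃ y := by
  have e : ∀ a b : V3, (R * hat a)ᵀ * (R * hat b) = -(hat a * hat b) := fun a b => by
    rw [Matrix.transpose_mul, hat_transpose]
    calc _ = -(hat a * (Rᵀ * R) * hat b) := by noncomm_ring
      _ = _ := by rw [SO3_transpose_mul h, mul_one]
  rw [bodyVel, bodyVel, e, e, ← vee_sub, ← vee_hat (x ⨯₃ y), hat_mul_hat_sub]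
  congr 1; noncomm_ring

/-! ### Bilinear maps in finite dimension -/

section Bilinear

variable {E F G : Type*} [NormedAddCommGroup E] [NormedSpace ℝ E] [FiniteDimensional ℝ E]
  [NormedAddCommGroup F] [NormedSpace ℝ F] [FiniteDimensional ℝ F]
  [NormedAddCommGroup G] [NormedSpace ℝ G]

/-- A bilinear map on finite-dimensional spaces as a continuous bilinear map. -/
noncomputable def LinearMap.toCLM₂ (f : E →ₗ[ℝ] F →ₗ[ℝ] G) : E →L[ℝ] F →L[ℝ] G :=
  LinearMap.toContinuousLinearMap
    ((LinearMap.toContinuousLinearMap : (F →ₗ[ℝ] G) ≃ₗ[ℝ] _).toLinearMap ∘ₗ f)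

@[simp] lemma LinearMap.toCLM₂_apply (f : E →ₗ[ℝ] F →ₗ[ℝ] G) (x : E) (y : F) :
    f.toCLM₂ x y = f x y := rfl

end Bilinear

lemma HasDerivAt.bilin {E F G : Type*} [NormedAddCommGroup E] [NormedSpace ℝ E]
    [NormedAddCommGroup F] [NormedSpace ℝ F] [NormedAddCommGroup G] [NormedSpace ℝ G]
    (B : E →L[ℝ] F →L[ℝ] G) {u : ℝ → E} {v : ℝ → F} {u' : E} {v' : F} {t : ℝ}
    (hu : HasDerivAt u u' t) (hv : HasDerivAt v v' t) :
    HasDerivAt (fun s => B (u s) (v s)) (B (u t) v' + B u' (v t)) t := by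
  simpa using (B.hasFDerivAt_of_bilinear hu.hasFDerivAt hv.hasFDerivAt).hasDerivAt

/-- `bodyVel` as a continuous bilinear map. -/
noncomputable def bodyVelL : M3 →L[ℝ] M3 →L[ℝ] V3 :=
  (LinearMap.mk₂ ℝ bodyVel
    (fun a b c => by simp only [bodyVel, Matrix.transpose_add, add_mul, vee_add])
    (fun r a b => by simp only [bodyVel, Matrix.transpose_smul, smul_mul_assoc, vee_smul])
    (fun a b c => by simp only [bodyVel, mul_add, vee_add])
    (fun r a b => by simp only [bodyVel, mul_smul_comm, vee_smul])).toCLM₂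

@[simp] lemma bodyVelL_apply (R S : M3) : bodyVelL R S = bodyVel R S := rfl

/-- `rotorVel` as a continuous bilinear map. -/
noncomputable def rotorVelL : (Fin 3 → ℂ) →L[ℝ] (Fin 3 → ℂ) →L[ℝ] V3 :=
  (LinearMap.mk₂ ℝ rotorVel
    (fun a b c => by ext i; simp [rotorVel]; ring)
    (fun r a b => by ext i; simp [rotorVel]; ring)
    (fun a b c => by ext i; simp [rotorVel]; ring)
    (fun r a b => by ext i; simp [rotorVel]; ring)).toCLM₂

@[simp] lemma rotorVelL_apply (z w : Fin 3 → ℂ) : rotorVelL z w = rotorVel z w := rfl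

/-- The cross product as a continuous bilinear map. -/
noncomputable def crossL : V3 →L[ℝ] V3 →L[ℝ] V3 := (crossProduct (R := ℝ)).toCLM₂

@[simp] lemma crossL_apply (x y : V3) : crossL x y = x ⨯₃ y := rfl

/-- The bilinear form of a matrix as a continuous bilinear map. -/
noncomputable def quadL (K : M3) : V3 →L[ℝ] V3 →L[ℝ] ℝ := (Matrix.toLinearMap₂' ℝ K).toCLM₂

@[simp] lemma quadL_apply (K : M3) (x y : V3) : quadL K x y = x ⬝ᵥ (K *ᵥ y) := by
  rw [quadL, LinearMap.toCLM₂_apply, Matrix.toLinearMap₂'_apply']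

/-- The action of matrices on vectors as a continuous bilinear map. -/
noncomputable def mulVecL : M3 →L[ℝ] V3 →L[ℝ] V3 :=
  (LinearMap.mk₂ ℝ (fun (a : M3) (x : V3) => a *ᵥ x)
    Matrix.add_mulVec Matrix.smul_mulVec Matrix.mulVec_add
    (fun c a x => Matrix.mulVec_smul a c x)).toCLM₂

/-- The hat map as a continuous linear map. -/
noncomputable def hatL : V3 →L[ℝ] M3 :=
  LinearMap.toContinuousLinearMap ⟨⟨hat, hat_add⟩, hat_smul⟩

/-- The map `vee` as a continuous linear map. -/
noncomputable def veeL : M3 →L[ℝ] V3 :=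
  LinearMap.toContinuousLinearMap ⟨⟨vee, vee_add⟩, vee_smul⟩

/-- Transposition as a continuous linear map. -/
noncomputable def transposeL : M3 →L[ℝ] M3 :=
  LinearMap.toContinuousLinearMap (Matrix.transposeLinearEquiv (Fin 3) (Fin 3) ℝ ℝ).toLinearMap

/-! ### One-parameter groups and tangent vectors -/

open Filter Topology

lemma contDiff_exp_smul {𝔸 : Type*} [NormedRing 𝔸] [NormedAlgebra ℝ 𝔸] [CompleteSpace 𝔸] (a : 𝔸) :
    ContDiff ℝ ∞ (fun t : ℝ => NormedSpace.exp (t • a)) := by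
  have h : ContDiff ℝ ∞ (NormedSpace.exp : 𝔸 → 𝔸) :=
    AnalyticOnNhd.contDiff fun x _ => NormedSpace.exp_analytic x
  exact h.comp (contDiff_id.smul contDiff_const)

lemma hasDerivAt_exp_smul_zero {𝔸 : Type*} [NormedRing 𝔸] [NormedAlgebra ℝ 𝔸] [CompleteSpace 𝔸]
    (a : 𝔸) : HasDerivAt (fun t : ℝ => NormedSpace.exp (t • a)) a 0 := by
  simpa using hasDerivAt_exp_smul_const (𝕂 := ℝ) a 0

lemma exp_mem_SO3 {a : M3} (h : aᵀ = -a) : NormedSpace.exp a ∈ SO3 := by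
  have orth : ∀ b : M3, bᵀ = -b → (NormedSpace.exp b)ᵀ * NormedSpace.exp b = 1 := fun b hb => by
    rw [← Matrix.exp_transpose, hb, ← Matrix.exp_add_of_commute _ _ ((Commute.refl b).neg_left),
      neg_add_cancel, NormedSpace.exp_zero]
  refine mem_SO3_iff.2 ⟨orth a h, ?_⟩
  -- Orthogonality alone leaves the determinant equal to ±1. Since `exp a` is the square of the
  -- orthogonal matrix `exp (a / 2)`, the sign is positive.
  have h2 := orth ((1 / 2 : ℝ) • a) (by rw [Matrix.transpose_smul, h, smul_neg])
  have e : NormedSpace.exp a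
      = NormedSpace.exp ((1 / 2 : ℝ) • a) * NormedSpace.exp ((1 / 2 : ℝ) • a) := by
    rw [← Matrix.exp_add_of_commute _ _ rfl, ← add_smul]; norm_num
  rw [e, Matrix.det_mul]
  simpa using congrArg Matrix.det h2

/-- Differentiating `Rᵀ R = 1` shows that `Rᵀ u` is skew. Membership is only required near `t`, so
that the lemma also serves curves defined on an open interval. -/
lemma SO3_velocity {c : ℝ → M3} {u : M3} {t : ℝ} (hc : ∀ᶠ s in 𝓝 t, c s ∈ SO3)
    (h : HasDerivAt c u t) : u = c t * hat (bodyVel (c t) u) := by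
  have h1 : HasDerivAt (fun s => (c s)ᵀ * c s) (uᵀ * c t + (c t)ᵀ * u) t :=
    (transposeL.hasFDerivAt.comp_hasDerivAt t h).mul h
  have h2 : HasDerivAt (fun s => (c s)ᵀ * c s) 0 t :=
    (hasDerivAt_const t (1 : M3)).congr_of_eventuallyEq
      (hc.mono fun s hs => SO3_transpose_mul hs)
  have h3 : ((c t)ᵀ * u)ᵀ = -((c t)ᵀ * u) := by
    rw [Matrix.transpose_mul, Matrix.transpose_transpose]
    exact eq_neg_of_add_eq_zero_left (h1.unique h2)
  rw [bodyVel, hat_vee h3, ← mul_assoc, SO3_mul_transpose hc.self_of_nhds, one_mul]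

lemma mem_tangentAt_SO3 {R u : M3} : u ∈ tangentAt SO3 R ↔ R ∈ SO3 ∧ ∃ x, u = R * hat x := by
  constructor
  · rintro ⟨c, -, hc, rfl, h⟩
    exact ⟨hc 0, _, SO3_velocity (Eventually.of_forall hc) h⟩
  · rintro ⟨hR, x, rfl⟩
    refine ⟨fun t => R * NormedSpace.exp (t • hat x), contDiff_const.mul (contDiff_exp_smul _),
      fun t => SO3_mul hR (exp_mem_SO3 ?_), by simp, (hasDerivAt_exp_smul_zero _).const_mul R⟩
    rw [Matrix.transpose_smul, hat_transpose, smul_neg]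

/-! ### The torus and the tangent spaces of the configuration space. -/

/-- The element `i a` of the Lie algebra of the torus. -/
noncomputable def imag (a : V3) : Fin 3 → ℂ := fun i => (a i : ℂ) * Complex.I

lemma imag_add (a b : V3) : imag (a + b) = imag a + imag b := by
  ext i; simp [imag, add_mul]

lemma imag_smul (r : ℝ) (a : V3) : imag (r • a) = r • imag a := by
  ext i; simp [imag, mul_assoc]

lemma imag_injective : Function.Injective imag := fun a b h => by
  ext i; simpa [imag] using congrFun h i

lemma mem_unitary_iff_mem_T3 {z : Fin 3 → ℂ} : z ∈ unitary (Fin 3 → ℂ) ↔ z ∈ T3 := by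
  rw [Unitary.mem_iff_star_mul_self, funext_iff]
  refine forall_congr' fun i => ?_
  simp only [Pi.mul_apply, Pi.star_apply, Pi.one_apply, RCLike.star_def, Complex.conj_mul']
  norm_cast
  exact pow_eq_one_iff_of_nonneg (norm_nonneg _) two_ne_zero

lemma T3_mul {z w : Fin 3 → ℂ} (hz : z ∈ T3) (hw : w ∈ T3) : z * w ∈ T3 := fun i => by
  simp [hz i, hw i]

lemma one_mem_T3 : (1 : Fin 3 → ℂ) ∈ T3 := fun i => by simp

lemma T3_star_mul {z : Fin 3 → ℂ} (h : z ∈ T3) : star z * z = 1 :=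
  (Unitary.mem_iff.1 (mem_unitary_iff_mem_T3.2 h)).1

lemma T3_mul_star {z : Fin 3 → ℂ} (h : z ∈ T3) : z * star z = 1 :=
  (Unitary.mem_iff.1 (mem_unitary_iff_mem_T3.2 h)).2

lemma exp_imag_mem_T3 (a : V3) : NormedSpace.exp (imag a) ∈ T3 := fun i => by
  rw [Pi.coe_exp, ← Complex.exp_eq_exp_ℂ, imag, Complex.norm_exp_ofReal_mul_I]

lemma rotorVel_eq (z w : Fin 3 → ℂ) (i : Fin 3) : rotorVel z w i = ((star z * w) i).im := rfl

lemma rotorVel_imag_mul {z : Fin 3 → ℂ} (h : z ∈ T3) (a : V3) : rotorVel z (imag a * z) = a := by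
  ext i
  rw [rotorVel_eq, mul_left_comm, T3_star_mul h, mul_one]
  simp [imag]

/-- The product of the conjugate of `i a z` with `i b z` is real. This is the abelian counterpart of
`bodyVel_mul_hat_sub`: the rotors add nothing to the curvature and no bracket term to a variation.
-/
lemma rotorVel_imag_imag (z : Fin 3 → ℂ) (a b : V3) : rotorVel (imag a * z) (imag b * z) = 0 := by
  ext i
  simp [rotorVel, imag]
  ring

lemma rotorVel_mul_left {g : Fin 3 → ℂ} (h : g ∈ T3) (z w : Fin 3 → ℂ) :
    rotorVel (g * z) (g * w) = rotorVel z w := by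
  ext i
  have e : star (g * z) * (g * w) = star z * (star g * g) * w := by rw [star_mul]; ring
  rw [rotorVel_eq, rotorVel_eq, e, T3_star_mul h, mul_one]

lemma T3_velocity {c : ℝ → Fin 3 → ℂ} {u : Fin 3 → ℂ} {t : ℝ} (hc : ∀ᶠ s in 𝓝 t, c s ∈ T3)
    (h : HasDerivAt c u t) : u = imag (rotorVel (c t) u) * c t := by
  have h1 : HasDerivAt (fun s => star (c s) * c s) (star u * c t + star (c t) * u) t :=
    h.star.mul h
  have h2 : HasDerivAt (fun s => star (c s) * c s) 0 t :=
    (hasDerivAt_const t (1 : Fin 3 → ℂ)).congr_of_eventuallyEq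
      (hc.mono fun s hs => T3_star_mul hs)
  have h3 := h1.unique h2
  have h4 : imag (rotorVel (c t) u) = star (c t) * u := by
    ext i
    have h5 := congrArg Complex.re (congrFun h3 i)
    apply Complex.ext
    · simp [imag] at h5 ⊢; linarith
    · simp [imag, rotorVel]
  rw [h4, mul_right_comm, T3_star_mul hc.self_of_nhds, one_mul]

lemma mem_tangentAt_prod {q u : M3 × (Fin 3 → ℂ)} : u ∈ tangentAt (SO3 ×ˢ T3) q ↔
    q ∈ SO3 ×ˢ T3 ∧ ∃ x a, u = (q.1 * hat x, imag a * q.2) := by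
  constructor
  · rintro ⟨c, -, hc, rfl, h⟩
    exact ⟨hc 0, _, _, Prod.ext
      (SO3_velocity (Eventually.of_forall fun s => (hc s).1) h.fst)
      (T3_velocity (Eventually.of_forall fun s => (hc s).2) h.snd)⟩
  · rintro ⟨⟨hR, hz⟩, x, a, rfl⟩
    refine ⟨fun t => (q.1 * NormedSpace.exp (t • hat x), NormedSpace.exp (t • imag a) * q.2),
      (contDiff_const.mul (contDiff_exp_smul _)).prodMk
        ((contDiff_exp_smul _).mul contDiff_const),
      fun t => ⟨SO3_mul hR (exp_mem_SO3 ?_), T3_mul ?_ hz⟩, by simp,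
      ((hasDerivAt_exp_smul_zero _).const_mul q.1).prodMk
        ((hasDerivAt_exp_smul_zero _).mul_const q.2)⟩
    · rw [Matrix.transpose_smul, hat_transpose, smul_neg]
    · rw [← imag_smul]; exact exp_imag_mem_T3 _

/-! ### Compactness of the two symmetry groups. -/

lemma isCompact_SO3 : IsCompact SO3 := by
  have hc : IsClosed SO3 := by
    have : SO3 = {R : M3 | Rᵀ * R = 1} ∩ {R | R.det = 1} := by
      ext R; exact mem_SO3_iff
    rw [this]
    exact (isClosed_eq (by fun_prop) continuous_const).inter
      (isClosed_eq (by fun_prop) continuous_const)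
  refine Metric.isCompact_of_isClosed_isBounded hc ?_
  -- The entries of an orthogonal matrix lie in `[-1, 1]`, but the norm on matrices is an operator
  -- norm. Passing through compactness of the box, a purely topological property, avoids comparing
  -- norms.
  have : IsCompact (Set.univ.pi fun _ : Fin 3 => Set.univ.pi fun _ : Fin 3 => Set.Icc (-1 : ℝ) 1) :=
    isCompact_univ_pi fun _ => isCompact_univ_pi fun _ => isCompact_Icc
  refine (this.image (f := (Matrix.of : (Fin 3 → Fin 3 → ℝ) → M3))
    continuous_id).isBounded.subset fun R hR => ⟨R, fun i _ j _ => abs_le.1 ?_, rfl⟩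
  exact entry_norm_bound_of_unitary (𝕜 := ℝ)
    (Matrix.specialUnitaryGroup_le_unitaryGroup hR) i j

lemma isCompact_T3 : IsCompact T3 := by
  have : T3 = Set.univ.pi fun _ : Fin 3 => Metric.sphere (0 : ℂ) 1 := by
    ext z; simp [T3]
  rw [this]
  exact isCompact_univ_pi fun _ => isCompact_sphere _ _

/-! ### Smoothness of the basic operations -/

section Smooth

variable {E : Type*} [NormedAddCommGroup E] [NormedSpace ℝ E]

lemma ContDiff.bodyVel {f g : E → M3} (hf : ContDiff ℝ ∞ f) (hg : ContDiff ℝ ∞ g) :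
    ContDiff ℝ ∞ (fun x => bodyVel (f x) (g x)) :=
  bodyVelL.isBoundedBilinearMap.contDiff.comp (hf.prodMk hg)

lemma ContDiff.rotorVel {f g : E → Fin 3 → ℂ} (hf : ContDiff ℝ ∞ f) (hg : ContDiff ℝ ∞ g) :
    ContDiff ℝ ∞ (fun x => rotorVel (f x) (g x)) :=
  rotorVelL.isBoundedBilinearMap.contDiff.comp (hf.prodMk hg)

lemma ContDiff.cross {f g : E → V3} (hf : ContDiff ℝ ∞ f) (hg : ContDiff ℝ ∞ g) :
    ContDiff ℝ ∞ (fun x => f x ⨯₃ g x) :=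
  crossL.isBoundedBilinearMap.contDiff.comp (hf.prodMk hg)

lemma ContDiff.quad (K : M3) {f g : E → V3} (hf : ContDiff ℝ ∞ f) (hg : ContDiff ℝ ∞ g) :
    ContDiff ℝ ∞ (fun x => f x ⬝ᵥ (K *ᵥ g x)) := by
  simpa [Function.comp_def] using (quadL K).isBoundedBilinearMap.contDiff.comp (hf.prodMk hg)

lemma ContDiff.mulVec {f : E → M3} {g : E → V3} (hf : ContDiff ℝ ∞ f) (hg : ContDiff ℝ ∞ g) :
    ContDiff ℝ ∞ (fun x => f x *ᵥ g x) :=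
  mulVecL.isBoundedBilinearMap.contDiff.comp (hf.prodMk hg)

lemma ContDiff.matTranspose {f : E → M3} (hf : ContDiff ℝ ∞ f) : ContDiff ℝ ∞ (fun x => (f x)ᵀ) :=
  transposeL.contDiff.comp hf

lemma ContDiff.vee {f : E → M3} (hf : ContDiff ℝ ∞ f) : ContDiff ℝ ∞ (fun x => vee (f x)) :=
  veeL.contDiff.comp hf

end Smooth

/-! ### The three bundles are Lagrange-Poincaré bundles -/

lemma two_le_infty : (2 : WithTop ℕ∞) ≤ ∞ :=
  WithTop.coe_le_coe.2 (le_top : ((2 : ℕ) : ℕ∞) ≤ ⊤)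

section Jacobi

variable {E F : Type*} [NormedAddCommGroup E] [NormedSpace ℝ E]
  [NormedAddCommGroup F] [NormedSpace ℝ F]

lemma lieBracket_jacobi {X Y Z : E → E} (hX : ContDiff ℝ ∞ X) (hY : ContDiff ℝ ∞ Y)
    (hZ : ContDiff ℝ ∞ Z) (q : E) :
    VectorField.lieBracket ℝ X (VectorField.lieBracket ℝ Y Z) q
      + VectorField.lieBracket ℝ Y (VectorField.lieBracket ℝ Z X) q
      + VectorField.lieBracket ℝ Z (VectorField.lieBracket ℝ X Y) q = 0 := by
  have h := VectorField.leibniz_identity_lieBracket (𝕜 := ℝ) (n := ∞) (x := q)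
    (by rw [minSmoothness_of_isRCLikeNormedField]; exact two_le_infty) hX.contDiffAt hY.contDiffAt hZ.contDiffAt
  have e : VectorField.lieBracket ℝ Z X = (-1 : ℝ) • VectorField.lieBracket ℝ X Z := by
    ext x; simp [VectorField.lieBracket]
  have d : DifferentiableAt ℝ (VectorField.lieBracket ℝ X Z) q := by
    have d1 : ∀ {W : E → E}, ContDiff ℝ ∞ W → DifferentiableAt ℝ (fderiv ℝ W) q := fun h =>
      ((h.fderiv_right (m := 1) two_le_infty).differentiable (by simp)).differentiableAt
    have d0 : ∀ {W : E → E}, ContDiff ℝ ∞ W → DifferentiableAt ℝ W q := fun h =>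
      (h.differentiable (by simp)).differentiableAt
    exact ((d1 hZ).clm_apply (d0 hX)).sub ((d1 hX).clm_apply (d0 hZ))
  rw [h, e, VectorField.lieBracket_const_smul_right d,
    VectorField.lieBracket_swap (V := VectorField.lieBracket ℝ X Y)]
  simp

lemma ContDiff.fderiv_fderiv_comm {w : E → F} (hw : ContDiff ℝ ∞ w) (q u v : E) :
    fderiv ℝ (fderiv ℝ w) q u v = fderiv ℝ (fderiv ℝ w) q v u :=
  (hw.contDiffAt.isSymmSndFDerivAt (by rw [minSmoothness_of_isRCLikeNormedField]; exact two_le_infty)).eq u v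

lemma ContDiff.fderiv_fderiv_apply {w : E → F} {X : E → E} (hw : ContDiff ℝ ∞ w)
    (hX : ContDiff ℝ ∞ X) (q : E) :
    HasFDerivAt (fun p => fderiv ℝ w p (X p))
      ((fderiv ℝ w q).comp (fderiv ℝ X q) + (fderiv ℝ (fderiv ℝ w) q).flip (X q)) q :=
  ((hw.fderiv_right (m := 1) two_le_infty).differentiable (by simp)).differentiableAt.hasFDerivAt.clm_apply
    (hX.differentiable (by simp)).differentiableAt.hasFDerivAt

/-- The cyclic sum of iterated section brackets, for vanishing connection and fibre bracket and
the two-form `C (β q b) (β q a)`. -/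
lemma cyclic_sectionBracket_snd {G : Type*} [NormedAddCommGroup G] [NormedSpace ℝ G]
    (M : Set E) (β : E →L[ℝ] E →L[ℝ] G) (C : G →L[ℝ] G →L[ℝ] F)
    {f : E → E → G} (hf : ∀ a b, β a b = f a b) {c : G → G → F} (hc : ∀ a b, C a b = c a b)
    {X Y Z : E → E} {u v w : E → F} (hX : ContDiff ℝ ∞ X) (hY : ContDiff ℝ ∞ Y)
    (hZ : ContDiff ℝ ∞ Z) (hu : ContDiff ℝ ∞ u) (hv : ContDiff ℝ ∞ v) (hw : ContDiff ℝ ∞ w)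
    (q : E) (B : LPBundle E F)
    (hB : B = ⟨M, fun _ _ _ => 0, fun q a b => c (f q b) (f q a), fun _ _ _ => 0⟩) :
    ∃ b₁₂ b₁₃ b₂₁ b₂₃ b₃₁ b₃₂ : G,
    (B.sectionBracket (X, u) (B.sectionBracket (Y, v) (Z, w))).2 q
      + (B.sectionBracket (Y, v) (B.sectionBracket (Z, w) (X, u))).2 q
      + (B.sectionBracket (Z, w) (B.sectionBracket (X, u) (Y, v))).2 q
    = -((c (f (X q) (Z q) + b₃₁) (f q (Y q)) + c (f q (Z q)) (f (X q) (Y q) + b₂₁)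
          + c (b₃₂ - b₂₃) (f q (X q)))
        + (c (f (Y q) (X q) + b₁₂) (f q (Z q)) + c (f q (X q)) (f (Y q) (Z q) + b₃₂)
          + c (b₁₃ - b₃₁) (f q (Y q)))
        + (c (f (Z q) (Y q) + b₂₃) (f q (X q)) + c (f q (Y q)) (f (Z q) (X q) + b₁₃)
          + c (b₂₁ - b₁₂) (f q (Z q)))) := by
  -- The six vectors are the values of `β q` on the derivatives of one field along another. They are
  -- hidden behind an existential because the cyclic sum vanishes whatever they are.
  refine ⟨β q (fderiv ℝ X q (Y q)), β q (fderiv ℝ X q (Z q)), β q (fderiv ℝ Y q (X q)),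
    β q (fderiv ℝ Y q (Z q)), β q (fderiv ℝ Z q (X q)), β q (fderiv ℝ Z q (Y q)), ?_⟩
  simp only [← hf, ← hc] at hB ⊢
  have key : ∀ {X Y Z : E → E} {u v w : E → F}, ContDiff ℝ ∞ X → ContDiff ℝ ∞ Y →
      ContDiff ℝ ∞ Z → ContDiff ℝ ∞ u → ContDiff ℝ ∞ v → ContDiff ℝ ∞ w →
      (B.sectionBracket (X, u) (B.sectionBracket (Y, v) (Z, w))).2 q
        = fderiv ℝ (fderiv ℝ w) q (X q) (Y q) + fderiv ℝ w q (fderiv ℝ Y q (X q))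
          - fderiv ℝ (fderiv ℝ v) q (X q) (Z q) - fderiv ℝ v q (fderiv ℝ Z q (X q))
          - fderiv ℝ u q (fderiv ℝ Z q (Y q)) + fderiv ℝ u q (fderiv ℝ Y q (Z q))
          - (C (β (X q) (Z q) + β q (fderiv ℝ Z q (X q))) (β q (Y q))
            + C (β q (Z q)) (β (X q) (Y q) + β q (fderiv ℝ Y q (X q)))
            + C (β q (fderiv ℝ Z q (Y q)) - β q (fderiv ℝ Y q (Z q))) (β q (X q))) := by
    intro X Y Z u v w hX hY hZ hu hv hw
    have h1 : ∀ {W : E → E}, ContDiff ℝ ∞ W → HasFDerivAt (fun q => β q (W q)) _ q := fun h =>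
      β.hasFDerivAt_of_bilinear (hasFDerivAt_id q)
        (h.differentiable (by simp)).differentiableAt.hasFDerivAt
    have h : HasFDerivAt (fun p => fderiv ℝ w p (Y p) - fderiv ℝ v p (Z p)
        - C (β p (Z p)) (β p (Y p))) _ q :=
      ((hw.fderiv_fderiv_apply hY q).sub (hv.fderiv_fderiv_apply hZ q)).sub
        (C.hasFDerivAt_of_bilinear (h1 hZ) (h1 hY))
    simp only [hB, LPBundle.sectionBracket, add_zero, VectorField.lieBracket]
    rw [h.fderiv]
    simp
    abel
  -- Symmetry of second derivatives cancels the second-order terms of `u`, `v`, `w`; their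
  -- first-order terms cancel against those coming from the Lie brackets. Only the exterior
  -- derivative of the two-form remains.
  rw [key hX hY hZ hu hv hw, key hY hZ hX hv hw hu, key hZ hX hY hw hu hv,
    hu.fderiv_fderiv_comm q (Z q) (Y q), hv.fderiv_fderiv_comm q (X q) (Z q),
    hw.fderiv_fderiv_comm q (Y q) (X q)]
  abel

end Jacobi

/-- The exterior derivative of the two-form of `bodyBundle` vanishes; `c`, `b` stand for the
derivatives of the base point and of the vector fields. -/
lemma cross_cyclic_eq_zero (x₁ x₂ x₃ b₁₂ b₁₃ b₂₁ b₂₃ b₃₁ b₃₂ c₁₂ c₂₃ c₃₁ : V3) :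
    ((c₃₁ + x₃ ⨯₃ x₁ + b₃₁) ⨯₃ x₂ + x₃ ⨯₃ (c₁₂ + b₂₁) + (b₃₂ - b₂₃) ⨯₃ x₁)
      + ((c₁₂ + x₁ ⨯₃ x₂ + b₁₂) ⨯₃ x₃ + x₁ ⨯₃ (c₂₃ + b₃₂) + (b₁₃ - b₃₁) ⨯₃ x₂)
      + ((c₂₃ + x₂ ⨯₃ x₃ + b₂₃) ⨯₃ x₁ + x₂ ⨯₃ (c₃₁ + b₁₃) + (b₂₁ - b₁₂) ⨯₃ x₃) = 0 := by
  -- The `b` and `c` terms cancel in pairs by antisymmetry; the three iterated products that remain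
  -- are the Jacobi identity of `ℝ³`.
  simp only [map_add, map_sub, LinearMap.add_apply, LinearMap.sub_apply]
  ext k
  fin_cases k <;> simp [cross_apply] <;> ring

lemma bodyBundle_isLP : bodyBundle.IsLP where
  smooth_bracket := contDiff_const
  smooth_form := (contDiff_fst.bodyVel contDiff_snd.snd).cross
    (contDiff_fst.bodyVel contDiff_snd.fst)
  smooth_conn := contDiff_const
  bracket_linear _ _ _ := by constructor <;> simp [bodyBundle]
  bracket_skew _ _ _ _ := by simp [bodyBundle]
  bracket_jacobi _ _ _ _ _ := by simp [bodyBundle]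
  form_linear R _ u := by
    constructor
    · intro x y
      simp only [bodyBundle, ← bodyVelL_apply, map_add, LinearMap.add_apply]
    · intro r x
      simp only [bodyBundle, ← bodyVelL_apply, map_smul, LinearMap.smul_apply]
  form_skew _ _ _ _ := (cross_anticomm _ _).symm
  conn_linear_left _ _ _ := by constructor <;> simp [bodyBundle]
  conn_linear_right _ _ _ := by constructor <;> simp [bodyBundle]
  jacobi := by
    rintro ⟨X, u⟩ ⟨Y, v⟩ ⟨Z, w⟩ ⟨hX, hu, tX⟩ ⟨hY, hv, tY⟩ ⟨hZ, hw, tZ⟩ R hR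
    refine ⟨lieBracket_jacobi hX hY hZ R, ?_⟩
    simp only at hX hu tX hY hv tY hZ hw tZ
    obtain ⟨-, x, hx⟩ := mem_tangentAt_SO3.1 (tX R hR)
    obtain ⟨-, y, hy⟩ := mem_tangentAt_SO3.1 (tY R hR)
    obtain ⟨-, z, hz⟩ := mem_tangentAt_SO3.1 (tZ R hR)
    obtain ⟨b₁₂, b₁₃, b₂₁, b₂₃, b₃₁, b₃₂, key⟩ := cyclic_sectionBracket_snd SO3 bodyVelL crossL
      bodyVelL_apply crossL_apply hX hY hZ hu hv hw R bodyBundle rfl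
    refine key.trans ?_
    -- Tangency of the fields enters here: exchanging the two arguments of the base-point derivative
    -- costs a cross product.
    have c : ∀ a b : V3, bodyVel (R * hat b) (R * hat a)
        = bodyVel (R * hat a) (R * hat b) + a ⨯₃ b := fun a b => by
      rw [← bodyVel_mul_hat_sub hR]; abel
    have e := cross_cyclic_eq_zero x y z b₁₂ b₁₃ b₂₁ b₂₃ b₃₁ b₃₂ (bodyVel (X R) (Y R))
      (bodyVel (Y R) (Z R)) (bodyVel (Z R) (X R))
    have cxz : bodyVel (X R) (Z R) = bodyVel (Z R) (X R) + z ⨯₃ x := by rw [hx, hz, c]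
    have cyx : bodyVel (Y R) (X R) = bodyVel (X R) (Y R) + x ⨯₃ y := by rw [hx, hy, c]
    have czy : bodyVel (Z R) (Y R) = bodyVel (Y R) (Z R) + y ⨯₃ z := by rw [hy, hz, c]
    have bx : bodyVel R (X R) = x := by rw [hx, bodyVel_mul_hat hR]
    have by' : bodyVel R (Y R) = y := by rw [hy, bodyVel_mul_hat hR]
    have bz : bodyVel R (Z R) = z := by rw [hz, bodyVel_mul_hat hR]
    rw [cxz, cyx, czy, bx, by', bz]
    exact neg_eq_zero.2 e

lemma rotorBundle_isLP : rotorBundle.IsLP where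
  smooth_bracket := contDiff_const
  smooth_form := contDiff_const
  smooth_conn := contDiff_const
  bracket_linear _ _ _ := by constructor <;> simp [rotorBundle]
  bracket_skew _ _ _ _ := by simp [rotorBundle]
  bracket_jacobi _ _ _ _ _ := by simp [rotorBundle]
  form_linear _ _ _ := by constructor <;> simp [rotorBundle]
  form_skew _ _ _ _ := by simp [rotorBundle]
  conn_linear_left _ _ _ := by constructor <;> simp [rotorBundle]
  conn_linear_right _ _ _ := by constructor <;> simp [rotorBundle]
  jacobi _ _ _ h₁ h₂ h₃ q _ := ⟨lieBracket_jacobi h₁.1 h₂.1 h₃.1 q, Subsingleton.elim _ _⟩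

lemma pointBundle_isLP : pointBundle.IsLP where
  smooth_bracket := (contDiff_snd.fst.fst.cross contDiff_snd.snd.fst).prodMk
    (contDiff_snd.fst.fst.cross contDiff_snd.snd.fst)
  smooth_form := contDiff_const
  smooth_conn := contDiff_const
  bracket_linear _ _ _ := by constructor <;> simp [pointBundle]
  bracket_skew _ _ _ _ := by simp [pointBundle, cross_anticomm]
  bracket_jacobi _ _ _ _ _ := by simp [pointBundle, jacobi_cross]
  form_linear _ _ _ := by constructor <;> simp [pointBundle]
  form_skew _ _ _ _ := by simp [pointBundle]
  conn_linear_left _ _ _ := by constructor <;> simp [pointBundle]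
  conn_linear_right _ _ _ := by constructor <;> simp [pointBundle]
  jacobi s₁ s₂ s₃ h₁ h₂ h₃ q _ := by
    refine ⟨Subsingleton.elim _ _, ?_⟩
    have e : ∀ (f : PUnit.{1} → V3 × V3) q u, fderiv ℝ f q u = 0 := fun f q u => by
      rw [Subsingleton.elim u 0, map_zero]
    simp [LPBundle.sectionBracket, pointBundle, e, jacobi_cross]

/-! ### Positive definite matrices -/

lemma Matrix.PosDef.quad_pos {K : M3} (hK : K.PosDef) {x : V3} (hx : x ≠ 0) :
    0 < x ⬝ᵥ (K *ᵥ x) := by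
  simpa using hK.dotProduct_mulVec_pos hx

lemma Matrix.PosDef.quad_comm {K : M3} (hK : K.PosDef) (x y : V3) :
    x ⬝ᵥ (K *ᵥ y) = y ⬝ᵥ (K *ᵥ x) := by
  have h : Kᵀ = K := by simpa using hK.isHermitian.eq
  rw [Matrix.dotProduct_mulVec, ← Matrix.mulVec_transpose, h, dotProduct_comm]

/-! ### Generalities on reduction steps -/

/-- Both actions and the projection to SO(3) are restrictions of linear maps of the ambient space,
so their tangent maps are given by the same formulas. -/
lemma fderiv_isLinearMap {E F : Type*} [NormedAddCommGroup E] [NormedSpace ℝ E]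
    [FiniteDimensional ℝ E] [NormedAddCommGroup F] [NormedSpace ℝ F] {f : E → F}
    (hf : IsLinearMap ℝ f) (q u : E) : fderiv ℝ f q u = f u := by
  have h : f = LinearMap.toContinuousLinearMap (IsLinearMap.mk' f hf) := rfl
  rw [h, ContinuousLinearMap.fderiv]

/-- Properness is automatic for a compact group: the set is the projection to `G` of a closed part
of the compact set `G × C`. -/
lemma isCompact_setOf_act_mem {𝔸 E : Type*} [TopologicalSpace 𝔸] [TopologicalSpace E] [T2Space E]
    {G : Set 𝔸} (hG : IsCompact G) {act : 𝔸 → E → E}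
    (hact : Continuous fun p : 𝔸 × E => act p.1 p.2) {C : Set E} (hC : IsCompact C) :
    IsCompact {g | g ∈ G ∧ ∃ q ∈ C, act g q ∈ C} := by
  have h := ((hG.prod hC).inter_right (hC.isClosed.preimage hact)).image continuous_fst
  convert h using 1
  ext g
  constructor
  · rintro ⟨hg, q, hq, hgq⟩
    exact ⟨(g, q), ⟨⟨hg, hq⟩, hgq⟩, rfl⟩
  · rintro ⟨⟨g, q⟩, ⟨⟨hg, hq⟩, hgq⟩, rfl⟩
    exact ⟨hg, q, hq, hgq⟩

/-! ### The action of the torus -/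

section Torus

lemma torus_act (z : Fin 3 → ℂ) (q : M3 × (Fin 3 → ℂ)) :
    torusSymmetry.act z q = (q.1, z * q.2) := rfl

lemma torus_tangentAct (z : Fin 3 → ℂ) (q u : M3 × (Fin 3 → ℂ)) :
    torusSymmetry.tangentAct z q u = (u.1, z * u.2) :=
  fderiv_isLinearMap (f := fun q : M3 × (Fin 3 → ℂ) => (q.1, z * q.2))
    ⟨fun x y => by simp [mul_add], fun c x => by simp⟩ q u

lemma torus_gen (a : V3) (q : M3 × (Fin 3 → ℂ)) : torusSymmetry.gen a q = (0, imag a * q.2) :=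
  ((hasDerivAt_const 0 q.1).prodMk
    ((hasDerivAt_exp_smul_zero (imag a)).mul_const q.2)).deriv

lemma bodyVel_zero (R : M3) : bodyVel R 0 = 0 := map_zero (bodyVelL R)

lemma mem_torus_group {z : Fin 3 → ℂ} : z ∈ torusSymmetry.group ↔ z ∈ T3 :=
  mem_unitary_iff_mem_T3

lemma torusConnection_gen {q : M3 × (Fin 3 → ℂ)} (hq : q ∈ SO3 ×ˢ T3) (a : V3) :
    torusConnection q (torusSymmetry.gen a q) = a := by
  rw [torus_gen, torusConnection, bodyVel_zero, rotorVel_imag_mul hq.2, zero_add]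

lemma torusConnection_add (q u w : M3 × (Fin 3 → ℂ)) :
    torusConnection q (u + w) = torusConnection q u + torusConnection q w := by
  have h1 : bodyVel q.1 (u.1 + w.1) = _ := map_add (bodyVelL q.1) _ _
  have h2 : rotorVel q.2 (u.2 + w.2) = _ := map_add (rotorVelL q.2) _ _
  simp only [bodyVelL_apply, rotorVelL_apply] at h1 h2
  simp only [torusConnection, Prod.fst_add, Prod.snd_add, h1, h2]
  abel

lemma torusConnection_smul (q u : M3 × (Fin 3 → ℂ)) (r : ℝ) :
    torusConnection q (r • u) = r • torusConnection q u := by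
  have h1 : bodyVel q.1 (r • u.1) = r • bodyVel q.1 u.1 := map_smul (bodyVelL q.1) _ _
  have h2 : rotorVel q.2 (r • u.2) = r • rotorVel q.2 u.2 := map_smul (rotorVelL q.2) _ _
  simp only [torusConnection, Prod.smul_fst, Prod.smul_snd, h1, h2, smul_add]

/-- Linearity in the base point makes the derivatives in the curvature formula computable: each is
the connection form evaluated at a tangent vector in place of the point. -/
lemma torusConnection_linear_left (w : M3 × (Fin 3 → ℂ)) :
    IsLinearMap ℝ (fun x => torusConnection x w) := by
  constructor
  · intro x y
    have h1 : bodyVel (x.1 + y.1) w.1 = _ := bodyVelL.map_add₂ _ _ _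
    have h2 : rotorVel (x.2 + y.2) w.2 = _ := rotorVelL.map_add₂ _ _ _
    simp only [bodyVelL_apply, rotorVelL_apply] at h1 h2
    simp only [torusConnection, Prod.fst_add, Prod.snd_add, h1, h2]
    abel
  · intro r x
    have h1 : bodyVel (r • x.1) w.1 = r • bodyVel x.1 w.1 := bodyVelL.map_smul₂ _ _ _
    have h2 : rotorVel (r • x.2) w.2 = r • rotorVel x.2 w.2 := rotorVelL.map_smul₂ _ _ _
    simp only [torusConnection, Prod.smul_fst, Prod.smul_snd, h1, h2, smul_add]

lemma torusConnection_tangent {q : M3 × (Fin 3 → ℂ)} (hq : q ∈ SO3 ×ˢ T3) (x a : V3) :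
    torusConnection q (q.1 * hat x, imag a * q.2) = x + a := by
  rw [torusConnection, bodyVel_mul_hat hq.1, rotorVel_imag_mul hq.2]

/-- Horizontal motion means `η = 0`: the rotors turn with velocity `-x` when the body turns with
`x`, whatever `a` was. -/
lemma torus_hor {q : M3 × (Fin 3 → ℂ)} (hq : q ∈ SO3 ×ˢ T3) (x a : V3) :
    torusSymmetry.hor torusConnection q (q.1 * hat x, imag a * q.2)
      = (q.1 * hat x, imag (-x) * q.2) := by
  rw [SymmetryData.hor, torusConnection_tangent hq, torus_gen, imag_add, ← neg_one_smul ℝ x,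
    imag_smul]
  ext1
  · simp
  · simp; ring

/-- By bilinearity, `dA(Hor u, Hor w)` is the antisymmetrization of the connection form in the two
horizontal vectors. The rotor terms drop out by `rotorVel_imag_imag`, and the body terms give the
Maurer–Cartan commutator. -/
lemma torus_curvature {q u w : M3 × (Fin 3 → ℂ)} (hu : u ∈ tangentAt (SO3 ×ˢ T3) q)
    (hw : w ∈ tangentAt (SO3 ×ˢ T3) q) :
    torusSymmetry.curvature torusConnection q u w = bodyVel q.1 w.1 ⨯₃ bodyVel q.1 u.1 := by
  obtain ⟨hq, x, a, rfl⟩ := mem_tangentAt_prod.1 hu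
  obtain ⟨-, y, b, rfl⟩ := mem_tangentAt_prod.1 hw
  have h := fun v z => fderiv_isLinearMap (torusConnection_linear_left v) q z
  rw [SymmetryData.curvature, torus_hor hq, torus_hor hq]
  refine (congrArg₂ (· - ·) (h _ _) (h _ _)).trans ?_
  simp only [torusConnection, rotorVel_imag_imag, add_zero, bodyVel_mul_hat hq.1]
  exact bodyVel_mul_hat_sub hq.1 y x

lemma torus_isLieGroup : torusSymmetry.IsLieGroup where
  closed := by
    have h : (torusSymmetry.group : Set (Fin 3 → ℂ)) = T3 := by ext z; exact mem_torus_group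
    rw [h]; exact isCompact_T3.isClosed
  inverse g hg := ⟨star g, (Unitary.star_mem hg), (Unitary.mem_iff.1 hg).2,
    (Unitary.mem_iff.1 hg).1⟩
  incl_linear := ⟨imag_add, imag_smul⟩
  incl_injective := imag_injective
  incl_range := by
    ext a
    constructor
    · rintro ⟨x, rfl⟩ t
      rw [mem_torus_group]
      change NormedSpace.exp (t • imag x) ∈ T3
      rw [← imag_smul]
      exact exp_imag_mem_T3 _
    · intro h
      -- A generator is the velocity at the identity of its own one-parameter group, hence purely
      -- imaginary.
      have h1 := T3_velocity (Eventually.of_forall fun s => mem_torus_group.1 (h s))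
        (hasDerivAt_exp_smul_zero a)
      simp only [zero_smul, NormedSpace.exp_zero, mul_one] at h1
      exact ⟨_, h1.symm⟩
  incl_lie x y := by
    change imag 0 = imag x * imag y - imag y * imag x
    rw [mul_comm, sub_self]
    ext i; simp [imag]

lemma torus_isLPAction : torusSymmetry.IsLPAction rotorBundle where
  smooth_act := contDiff_snd.fst.prodMk (contDiff_fst.mul contDiff_snd.snd)
  smooth_fibreAct := contDiff_snd.snd
  mem g hg q hq := ⟨hq.1, T3_mul (mem_torus_group.1 hg) hq.2⟩
  act_one q _ := by simp [torus_act]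
  act_mul g _ h _ q _ := by simp [torus_act, mul_assoc]
  fibreAct_one _ _ _ := rfl
  fibreAct_mul _ _ _ _ _ _ _ := rfl
  fibreAct_linear _ _ _ _ := ⟨fun _ _ => rfl, fun _ _ => rfl⟩
  free g _ q hq h := by
    have h1 : g * q.2 = q.2 := congrArg Prod.snd h
    have h2 := congrArg (· * star q.2) h1
    simpa [mul_assoc, T3_mul_star hq.2] using h2
  proper C _ hC := by
    have h := isCompact_setOf_act_mem isCompact_T3 (act := torusSymmetry.act)
      (Continuous.prodMk (by fun_prop) (by fun_prop)) hC
    simpa only [mem_torus_group] using h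
  bracket _ _ _ _ _ _ := rfl
  form _ _ _ _ _ _ _ _ := rfl
  conn _ _ _ _ _ _ _ := Subsingleton.elim _ _

lemma torus_isPrincipalConnection :
    torusSymmetry.IsPrincipalConnection (SO3 ×ˢ T3) torusConnection where
  smooth := (contDiff_fst.fst.bodyVel contDiff_snd.fst).add
    (contDiff_fst.snd.rotorVel contDiff_snd.snd)
  linear q := ⟨torusConnection_add q, fun r u => torusConnection_smul q u r⟩
  gen q hq a := torusConnection_gen hq a
  equivariant g hg q _ u _ := by
    rw [torus_tangentAct, mul_comm]
    congr 2
    simp only [torusConnection, torus_act, rotorVel_mul_left (mem_torus_group.1 hg)]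

lemma torus_invariant {g : Fin 3 → ℂ} (hg : g ∈ torusSymmetry.group) (q u : M3 × (Fin 3 → ℂ)) :
    rotorVel (torusSymmetry.act g q).2 (torusSymmetry.tangentAct g q u).2 = rotorVel q.2 u.2 := by
  rw [torus_tangentAct]
  exact rotorVel_mul_left (mem_torus_group.1 hg) _ _

lemma torus_isQuotientMap : torusSymmetry.IsQuotientMap (SO3 ×ˢ T3) SO3 Prod.fst where
  smooth := contDiff_fst
  image := Set.fst_image_prod _ ⟨1, one_mem_T3⟩
  fibre q₁ h₁ q₂ h₂ := by
    constructor
    · intro h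
      refine ⟨q₂.2 * star q₁.2, mem_torus_group.2 (T3_mul h₂.2 ?_), Prod.ext h ?_⟩
      · exact mem_torus_group.1 (Unitary.star_mem (mem_torus_group.2 h₁.2))
      · change q₂.2 * star q₁.2 * q₁.2 = q₂.2
        rw [mul_assoc, T3_star_mul h₁.2, mul_one]
    · rintro ⟨g, -, rfl⟩; rfl
  submersion q hq := by
    have h := fun u => fderiv_isLinearMap (f := (Prod.fst : M3 × (Fin 3 → ℂ) → M3))
      ⟨fun _ _ => rfl, fun _ _ => rfl⟩ q u
    ext X
    rw [mem_tangentAt_SO3]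
    constructor
    · rintro ⟨u, hu, rfl⟩
      obtain ⟨-, x, a, rfl⟩ := mem_tangentAt_prod.1 hu
      exact ⟨hq.1, x, h _⟩
    · rintro ⟨-, x, rfl⟩
      exact ⟨(q.1 * hat x, imag 0 * q.2), mem_tangentAt_prod.2 ⟨hq, x, 0, rfl⟩, h _⟩

lemma torus_isTrivialization : torusSymmetry.IsTrivialization (SO3 ×ˢ T3) torusTriv where
  smooth := contDiff_snd.fst
  linear _ _ := ⟨fun _ _ => rfl, fun _ _ => rfl⟩
  bijective _ _ := ⟨fun p p' h => Prod.ext h rfl, fun η => ⟨(η, PUnit.unit), rfl⟩⟩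
  invariant g hg q _ ξ ξ' h _ := by
    refine imag_injective ?_
    change imag ξ' * g = g * imag ξ at h
    -- The group is abelian, so its adjoint action is trivial and `ξ' = ξ`.
    have h2 := congrArg (· * star g) h
    rwa [mul_comm g, mul_assoc, mul_assoc, T3_mul_star (mem_torus_group.1 hg), mul_one,
      mul_one] at h2

lemma torus_isIdentification : torusSymmetry.IsIdentification rotorBundle SO3 torusConnection
    Prod.fst torusTriv where
  orbits := by
    rintro q₁ h₁ u₁ t₁ v₁ q₂ h₂ u₂ t₂ v₂
    have hd := fun q u => fderiv_isLinearMap (f := (Prod.fst : M3 × (Fin 3 → ℂ) → M3))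
      ⟨fun _ _ => rfl, fun _ _ => rfl⟩ q u
    obtain ⟨-, x, a, rfl⟩ := mem_tangentAt_prod.1 t₁
    obtain ⟨-, y, b, rfl⟩ := mem_tangentAt_prod.1 t₂
    have e : ∀ q ∈ SO3 ×ˢ T3, ∀ x a v, SymmetryData.identification torusConnection Prod.fst
        torusTriv q (q.1 * hat x, imag a * q.2) v = (q.1, q.1 * hat x, x + a) :=
      fun q hq x a v => Prod.ext rfl (Prod.ext (hd _ _) (torusConnection_tangent hq x a))
    rw [e _ h₁, e _ h₂]
    constructor
    · intro h
      have h3 : q₁.1 = q₂.1 := congrArg (fun p => p.1) h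
      have h4 : q₁.1 * hat x = q₂.1 * hat y := congrArg (fun p => p.2.1) h
      have h5 : x + a = y + b := congrArg (fun p => p.2.2) h
      have h6 : x = y := by
        rw [← bodyVel_mul_hat h₁.1 x, h4, h3, bodyVel_mul_hat h₂.1]
      have h7 : a = b := by rwa [h6, add_right_inj] at h5
      have hs := T3_star_mul h₁.2
      -- The only candidate group element: it carries the rotor phases of `q₁` to those of `q₂`.
      refine ⟨q₂.2 * star q₁.2, mem_torus_group.2 (T3_mul h₂.2 ?_), Prod.ext h3 ?_, ?_, rfl⟩
      · exact mem_torus_group.1 (Unitary.star_mem (mem_torus_group.2 h₁.2))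
      · change q₂.2 * star q₁.2 * q₁.2 = q₂.2
        rw [mul_assoc, hs, mul_one]
      · rw [torus_tangentAct]
        refine Prod.ext h4 ?_
        change q₂.2 * star q₁.2 * (imag a * q₁.2) = imag b * q₂.2
        calc _ = imag a * q₂.2 * (star q₁.2 * q₁.2) := by ring
          _ = _ := by rw [hs, mul_one, h7]
    · rintro ⟨g, hg, rfl, h3, -⟩
      have h4 := h3 ▸ torus_invariant hg q₁ (q₁.1 * hat x, imag a * q₁.2)
      rw [torus_tangentAct] at h3
      have h5 : q₁.1 * hat x = q₁.1 * hat y := congrArg Prod.fst h3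
      have h6 : x = y := by
        rw [← bodyVel_mul_hat h₁.1 x, h5, bodyVel_mul_hat h₁.1]
      rw [rotorVel_imag_mul h₁.2, rotorVel_imag_mul h₂.2] at h4
      rw [h6, h4, torus_act]
  surjective R hR X hX y := by
    obtain ⟨-, x, rfl⟩ := mem_tangentAt_SO3.1 hX
    -- Any phase can be chosen over `R`; the rotor velocity `y - x` is forced by `x + a = y`.
    have hq : (R, (1 : Fin 3 → ℂ)) ∈ SO3 ×ˢ T3 := ⟨hR, one_mem_T3⟩
    refine ⟨(R, 1), hq, (R * hat x, imag (y - x) * 1), mem_tangentAt_prod.2 ⟨hq, x, y - x, rfl⟩,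
      PUnit.unit, Prod.ext rfl (Prod.ext ?_ ?_)⟩
    · exact fderiv_isLinearMap (f := (Prod.fst : M3 × (Fin 3 → ℂ) → M3))
        ⟨fun _ _ => rfl, fun _ _ => rfl⟩ _ _
    · exact (torusConnection_tangent hq x (y - x)).trans (add_sub_cancel _ _)

lemma torus_isReducedBundle :
    torusSymmetry.IsReducedBundle rotorBundle torusConnection Prod.fst torusTriv bodyBundle where
  form q hq u hu w hw := by
    have hd := fun u => fderiv_isLinearMap (f := (Prod.fst : M3 × (Fin 3 → ℂ) → M3))
      ⟨fun _ _ => rfl, fun _ _ => rfl⟩ q u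
    refine (congrArg₂ (bodyBundle.form q.1) (hd u) (hd w)).trans (torus_curvature hu hw).symm
  bracket _ _ _ _ _ _ := rfl
  conn q ξ v _ _ _ t := by
    change deriv ξ t + 0 = deriv ξ t - 0
    rw [add_zero, sub_zero]

lemma torus_isReducedLagrangian (I K : M3) :
    torusSymmetry.IsReducedLagrangian rotorBundle torusConnection Prod.fst torusTriv
      (rotorLagrangian I K) (bodyLagrangian I K) where
  invariant g hg q _ u _ v := by
    simp only [rotorLagrangian, torus_invariant hg q u]
    rw [torus_tangentAct, torus_act]
  reduced q _ u _ v := by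
    have hd := fderiv_isLinearMap (f := (Prod.fst : M3 × (Fin 3 → ℂ) → M3))
      ⟨fun _ _ => rfl, fun _ _ => rfl⟩ q u
    exact congrArg (fun X => bodyLagrangian I K q.1 X (torusConnection q u)) hd

lemma torus_isReductionStep (I K : M3) :
    torusSymmetry.IsReductionStep rotorBundle (rotorLagrangian I K) torusConnection Prod.fst
      torusTriv bodyBundle (bodyLagrangian I K) where
  lieGroup := torus_isLieGroup
  source := rotorBundle_isLP
  action := torus_isLPAction
  quotient := torus_isQuotientMap
  connection := torus_isPrincipalConnection
  trivialization := torus_isTrivialization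
  ident := torus_isIdentification
  bundle := torus_isReducedBundle
  target := bodyBundle_isLP
  lagrangian := torus_isReducedLagrangian I K

lemma torus_isMechanical {I K : M3} (hI : I.PosDef) (hK : K.PosDef) :
    torusSymmetry.IsMechanical (SO3 ×ˢ T3) (rotorMetric I K) torusConnection where
  metric :=
    { smooth := by
        have h1 := contDiff_fst.fst.bodyVel (E := (M3 × (Fin 3 → ℂ)) × (M3 × (Fin 3 → ℂ)) ×
          (M3 × (Fin 3 → ℂ))) contDiff_snd.fst.fst
        have h2 := contDiff_fst.fst.bodyVel (E := (M3 × (Fin 3 → ℂ)) × (M3 × (Fin 3 → ℂ)) ×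
          (M3 × (Fin 3 → ℂ))) contDiff_snd.snd.fst
        exact (h2.quad I h1).add ((h2.add (contDiff_fst.snd.rotorVel contDiff_snd.snd.snd)).quad K
          (h1.add (contDiff_fst.snd.rotorVel contDiff_snd.fst.snd)))
      linear := fun q _ u => by
        have ha := torusConnection_add q
        have hs := fun w r => torusConnection_smul q w r
        have h1 : ∀ w w' : M3, bodyVel q.1 (w + w') = bodyVel q.1 w + bodyVel q.1 w' :=
          map_add (bodyVelL q.1)
        have h2 : ∀ (r : ℝ) (w : M3), bodyVel q.1 (r • w) = r • bodyVel q.1 w :=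
          map_smul (bodyVelL q.1)
        simp only [torusConnection] at ha hs
        constructor
        · intro w w'
          simp only [rotorMetric, ha]
          simp only [Prod.fst_add, h1, add_dotProduct]
          ring
        · intro r w
          simp only [rotorMetric, hs]
          simp only [Prod.smul_fst, h2, smul_dotProduct]
          exact (smul_add _ _ _).symm
      symm := fun q _ u w => by
        simp only [rotorMetric]
        rw [hI.quad_comm, hK.quad_comm]
      pos := fun q _ u hu h0 => by
        obtain ⟨hq, x, a, rfl⟩ := mem_tangentAt_prod.1 hu
        simp only [rotorMetric, bodyVel_mul_hat hq.1, rotorVel_imag_mul hq.2]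
        -- If the body is at rest, the rotor energy of `K` is positive; otherwise the energy of `I`
        -- is already positive and the other term is nonnegative.
        by_cases hx : x = 0
        · subst hx
          have ha : a ≠ 0 := fun ha => h0 (by
            subst ha
            have h1 : hat 0 = 0 := map_zero hatL
            have h2 : imag 0 = 0 := by ext i; simp [imag]
            rw [h1, h2, mul_zero, zero_mul]; rfl)
          simpa using hK.quad_pos ha
        · have h1 := hI.quad_pos hx
          have h2 : 0 ≤ (x + a) ⬝ᵥ (K *ᵥ (x + a)) := by
            simpa using hK.posSemidef.dotProduct_mulVec_nonneg (x + a)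
          linarith }
  invariant g hg q _ u _ w _ := by
    simp only [rotorMetric, torus_invariant hg q]
    rw [torus_tangentAct, torus_tangentAct, torus_act]
  orthogonal q hq u _ := by
    -- Against a vertical vector the metric sees only `K A(u)`. Taking `ξ = A(u)` and using
    -- definiteness of `K` turns orthogonality into `A(u) = 0`.
    have e : ∀ ξ, rotorMetric I K q u (torusSymmetry.gen ξ q)
        = ξ ⬝ᵥ (K *ᵥ torusConnection q u) := fun ξ => by
      rw [torus_gen, rotorMetric, bodyVel_zero, rotorVel_imag_mul hq.2, zero_dotProduct, zero_add,
        zero_add, torusConnection]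
    constructor
    · intro h ξ
      rw [e, h, Matrix.mulVec_zero, dotProduct_zero]
    · intro h
      by_contra h0
      exact (hK.quad_pos h0).ne' ((e _).symm.trans (h _))

end Torus

/-! ### The action of the rotation group -/

lemma curvature_eq_zero {𝔸 𝔤 E F : Type*} [NormedRing 𝔸] [NormedAlgebra ℝ 𝔸]
    [NormedAddCommGroup 𝔤] [NormedSpace ℝ 𝔤] [NormedAddCommGroup E] [NormedSpace ℝ E]
    (S : SymmetryData 𝔸 𝔤 E F) (A : E → E → 𝔤) {q u w : E} (hu : S.hor A q u = 0)
    (hw : S.hor A q w = 0) : S.curvature A q u w = 0 := by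
  rw [SymmetryData.curvature, hu, hw, map_zero, sub_zero]

section Rotation

lemma hat_mulVec (x y : V3) : hat x *ᵥ y = x ⨯₃ y := by
  ext i; fin_cases i <;> simp [hat, Matrix.mulVec, dotProduct, Fin.sum_univ_succ, cross_apply] <;>
    ring

lemma SO3_mulVec_transpose_mulVec {R : M3} (h : R ∈ SO3) (x : V3) : R *ᵥ (Rᵀ *ᵥ x) = x := by
  rw [Matrix.mulVec_mulVec, SO3_mul_transpose h, Matrix.one_mulVec]

lemma SO3_transpose_mulVec_mulVec {R : M3} (h : R ∈ SO3) (x : V3) : Rᵀ *ᵥ (R *ᵥ x) = x := by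
  rw [Matrix.mulVec_mulVec, SO3_transpose_mul h, Matrix.one_mulVec]

lemma rotation_tangentAct (g R u : M3) : rotationSymmetry.tangentAct g R u = g * u :=
  fderiv_isLinearMap (f := fun R : M3 => g * R) ⟨mul_add g, fun c x => mul_smul_comm c g x⟩ R u

lemma rotation_gen (ξ : V3) (R : M3) : rotationSymmetry.gen ξ R = hat ξ * R :=
  ((hasDerivAt_exp_smul_zero (hat ξ)).mul_const R).deriv

lemma rotationConnection_tangent {R : M3} (hR : R ∈ SO3) (x : V3) :
    rotationConnection R (R * hat x) = R *ᵥ x := by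
  rw [rotationConnection, ← SO3_hat_mulVec_mul hR, mul_assoc, SO3_mul_transpose hR, mul_one,
    vee_hat]

lemma rotationTriv_rotationConnection {R R' : M3} (hR' : R' ∈ tangentAt SO3 R) (η : V3) :
    rotationTriv R (rotationConnection R R') η = (bodyVel R R', η) := by
  obtain ⟨hR, x, rfl⟩ := mem_tangentAt_SO3.1 hR'
  rw [rotationTriv, rotationConnection_tangent hR, bodyVel_mul_hat hR,
    SO3_transpose_mulVec_mulVec hR]

/-- SO(3) acts transitively on itself, so every tangent vector is vertical; concretely, `R * hat x`
is the generator of `R x` at `R`. -/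
lemma rotation_hor {R u : M3} (hu : u ∈ tangentAt SO3 R) :
    rotationSymmetry.hor rotationConnection R u = 0 := by
  obtain ⟨hR, x, rfl⟩ := mem_tangentAt_SO3.1 hu
  rw [SymmetryData.hor, rotation_gen, rotationConnection_tangent hR, SO3_hat_mulVec_mul hR,
    sub_self]

/-- Invariant sections of the fibre part are constant, because the action on `η` and the connection
are both trivial. -/
lemma rotation_vertDeriv (ξ : V3) (R : M3) (v : V3) :
    rotationSymmetry.vertDeriv bodyBundle ξ R v = 0 :=
  (add_zero _).trans (deriv_const 0 v)

lemma bodyForm_zero_left (R u : M3) : bodyBundle.form R 0 u = 0 := by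
  change bodyVel R u ⨯₃ bodyVel R 0 = 0
  rw [bodyVel_zero, map_zero]

lemma bodyVel_rotation_gen {R : M3} (hR : R ∈ SO3) (ξ : V3) :
    bodyVel R (rotationSymmetry.gen ξ R) = Rᵀ *ᵥ ξ := by
  have h : hat ξ * R = R * hat (Rᵀ *ᵥ ξ) := by
    rw [← SO3_hat_mulVec_mul hR, SO3_mulVec_transpose_mulVec hR]
  rw [rotation_gen, h, bodyVel_mul_hat hR]

lemma rotation_isLieGroup : rotationSymmetry.IsLieGroup where
  closed := isCompact_SO3.isClosed
  inverse g hg := ⟨gᵀ, SO3_transpose hg, SO3_mul_transpose hg, SO3_transpose_mul hg⟩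
  incl_linear := ⟨hat_add, hat_smul⟩
  incl_injective := hat_injective
  incl_range := by
    ext a
    constructor
    · rintro ⟨x, rfl⟩ t
      refine exp_mem_SO3 ?_
      rw [Matrix.transpose_smul, ← smul_neg]
      exact congrArg (t • ·) (hat_transpose x)
    · intro h
      have h1 := SO3_velocity (Eventually.of_forall fun s => h s) (hasDerivAt_exp_smul_zero a)
      simp only [zero_smul, NormedSpace.exp_zero, one_mul] at h1
      exact ⟨_, h1.symm⟩
  incl_lie := hat_mul_hat_sub

lemma rotation_isLPAction : rotationSymmetry.IsLPAction bodyBundle where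
  smooth_act := contDiff_fst.mul contDiff_snd
  smooth_fibreAct := contDiff_snd.snd
  mem g hg q hq := SO3_mul hg hq
  act_one q _ := one_mul q
  act_mul g _ h _ q _ := mul_assoc g h q
  fibreAct_one _ _ _ := rfl
  fibreAct_mul _ _ _ _ _ _ _ := rfl
  fibreAct_linear _ _ _ _ := ⟨fun _ _ => rfl, fun _ _ => rfl⟩
  free g _ R hR h := by
    have h1 : g * R = R := h
    have h2 := congrArg (· * Rᵀ) h1
    simpa [mul_assoc, SO3_mul_transpose hR] using h2
  proper C _ hC := isCompact_setOf_act_mem isCompact_SO3 (act := rotationSymmetry.act)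
      (continuous_fst.mul continuous_snd) hC
  bracket _ _ _ _ _ _ := rfl
  form g hg R _ u _ w _ := by
    rw [rotation_tangentAct, rotation_tangentAct]
    exact (congrArg₂ (fun a b : V3 => a ⨯₃ b) (bodyVel_mul_left hg R w)
      (bodyVel_mul_left hg R u)).symm
  conn _ _ _ _ _ _ _ := rfl

lemma rotation_isPrincipalConnection :
    rotationSymmetry.IsPrincipalConnection SO3 rotationConnection where
  smooth := (contDiff_snd.mul contDiff_fst.matTranspose).vee
  linear R := ⟨fun a b => by simp only [rotationConnection, add_mul, vee_add],
    fun r a => by simp only [rotationConnection, smul_mul_assoc, vee_smul]⟩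
  gen R hR ξ := by
    rw [rotation_gen, rotationConnection, mul_assoc, SO3_mul_transpose hR, mul_one, vee_hat]
  equivariant g hg R hR u hu := by
    obtain ⟨-, x, rfl⟩ := mem_tangentAt_SO3.1 hu
    have h : rotationConnection (rotationSymmetry.act g R) (g * (R * hat x))
        = g *ᵥ (R *ᵥ x) := by
      rw [← mul_assoc, Matrix.mulVec_mulVec]
      exact rotationConnection_tangent (SO3_mul hg hR) x
    rw [rotation_tangentAct, h, rotationConnection_tangent hR]
    exact SO3_hat_mulVec_mul hg _

lemma tangentAt_univ_punit (q : PUnit.{1}) : tangentAt Set.univ q = {0} := by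
  ext u
  refine ⟨fun _ => Subsingleton.elim _ _, fun _ => ⟨fun _ => q, contDiff_const,
    fun _ => Set.mem_univ _, rfl, ?_⟩⟩
  rw [Subsingleton.elim u 0]
  exact hasDerivAt_const _ _

lemma zero_mem_tangentAt_SO3 {R : M3} (hR : R ∈ SO3) : (0 : M3) ∈ tangentAt SO3 R := by
  refine mem_tangentAt_SO3.2 ⟨hR, 0, ?_⟩
  have h1 : hat 0 = 0 := map_zero hatL
  rw [h1, mul_zero]

lemma rotation_isQuotientMap :
    rotationSymmetry.IsQuotientMap SO3 Set.univ (fun _ => PUnit.unit.{1}) where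
  smooth := contDiff_const
  image := by
    ext x
    exact ⟨fun _ => Set.mem_univ _, fun _ => ⟨1, one_mem_SO3, rfl⟩⟩
  fibre R hR S hS := by
    refine ⟨fun _ => ⟨S * Rᵀ, SO3_mul hS (SO3_transpose hR), ?_⟩, fun _ => rfl⟩
    change S * Rᵀ * R = S
    rw [mul_assoc, SO3_transpose_mul hR, mul_one]
  submersion R hR := by
    rw [tangentAt_univ_punit]
    ext x
    exact ⟨fun _ => Subsingleton.elim _ _,
      fun _ => ⟨0, zero_mem_tangentAt_SO3 hR, Subsingleton.elim _ _⟩⟩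

lemma rotation_isTrivialization : rotationSymmetry.IsTrivialization SO3 rotationTriv where
  smooth := (contDiff_fst.matTranspose.mulVec contDiff_snd.fst).prodMk contDiff_snd.snd
  linear R _ := ⟨fun p p' => Prod.ext (Matrix.mulVec_add Rᵀ p.1 p'.1) rfl,
    fun r p => Prod.ext (Matrix.mulVec_smul Rᵀ r p.1) rfl⟩
  bijective R hR := by
    constructor
    · intro p p' h
      have h1 : Rᵀ *ᵥ p.1 = Rᵀ *ᵥ p'.1 := congrArg Prod.fst h
      refine Prod.ext ?_ (congrArg (fun x => x.2) h)
      rw [← SO3_mulVec_transpose_mulVec hR p.1, h1, SO3_mulVec_transpose_mulVec hR]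
    · rintro ⟨x, η⟩
      exact ⟨(R *ᵥ x, η), Prod.ext (SO3_transpose_mulVec_mulVec hR x) rfl⟩
  invariant g hg R _ ξ ξ' h v := by
    have h1 : hat ξ' * g = hat (g *ᵥ ξ) * g := h.trans (SO3_hat_mulVec_mul hg ξ).symm
    have h2 := congrArg (· * gᵀ) h1
    simp only [mul_assoc, SO3_mul_transpose hg, mul_one] at h2
    refine Prod.ext ?_ rfl
    change (g * R)ᵀ *ᵥ ξ' = Rᵀ *ᵥ ξ
    rw [hat_injective h2, Matrix.transpose_mul, ← Matrix.mulVec_mulVec,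
      SO3_transpose_mulVec_mulVec hg]

lemma rotation_isIdentification : rotationSymmetry.IsIdentification bodyBundle Set.univ
    rotationConnection (fun _ => PUnit.unit.{1}) rotationTriv where
  orbits := by
    rintro R hR u hu v S hS w hw v'
    have e : ∀ {R u}, u ∈ tangentAt SO3 R → ∀ v, SymmetryData.identification rotationConnection
        (fun _ => PUnit.unit.{1}) rotationTriv R u v
          = (PUnit.unit, PUnit.unit, (bodyVel R u, v)) := fun hu v =>
      Prod.ext rfl (Prod.ext (Subsingleton.elim _ _) (rotationTriv_rotationConnection hu v))
    rw [e hu, e hw]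
    obtain ⟨-, x, rfl⟩ := mem_tangentAt_SO3.1 hu
    obtain ⟨-, y, rfl⟩ := mem_tangentAt_SO3.1 hw
    rw [bodyVel_mul_hat hR, bodyVel_mul_hat hS]
    constructor
    · intro h
      have h1 : x = y := congrArg (fun p => p.2.2.1) h
      have h2 : S * Rᵀ * R = S := by rw [mul_assoc, SO3_transpose_mul hR, mul_one]
      refine ⟨S * Rᵀ, SO3_mul hS (SO3_transpose hR), h2, ?_, congrArg (fun p => p.2.2.2) h⟩
      rw [rotation_tangentAct, ← mul_assoc, h2, h1]
    · rintro ⟨g, hg, rfl, h3, h4⟩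
      rw [rotation_tangentAct] at h3
      have h5 : x = y := by
        rw [← bodyVel_mul_hat hR x, ← bodyVel_mul_left hg, h3]
        exact bodyVel_mul_hat hS y
      rw [h5, ← h4]
      rfl
  surjective x _ X _ y := ⟨1, one_mem_SO3, 1 * hat y.1,
    mem_tangentAt_SO3.2 ⟨one_mem_SO3, y.1, rfl⟩, y.2, by
      refine Prod.ext rfl (Prod.ext (Subsingleton.elim _ _) ?_)
      refine (rotationTriv_rotationConnection
        (mem_tangentAt_SO3.2 ⟨one_mem_SO3, y.1, rfl⟩) y.2).trans ?_
      rw [bodyVel_mul_hat one_mem_SO3]⟩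

/-- The derivative of `Rᵀ ξ` is `Rᵀ (ξ' - (R x) × ξ)`: the trivialization by `Rᵀ` absorbs the term
`[A(Ṙ), ξ]`. This is why the reduced connection over the point is zero. -/
lemma rotation_covDeriv {R : ℝ → M3} {ξ v : ℝ → V3} {t : ℝ} {u : M3} {ξ' v' : V3}
    (hR : ∀ s, R s ∈ SO3) (dR : HasDerivAt R u t) (dξ : HasDerivAt ξ ξ' t)
    (dv : HasDerivAt v v' t) :
    pointBundle.covDeriv (fun _ => PUnit.unit) (fun s => rotationTriv (R s) (ξ s) (v s)) t
      = rotationTriv (R t) (deriv ξ t - rotationSymmetry.lie (rotationConnection (R t) u) (ξ t))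
        (bodyBundle.covDeriv R v t
          - rotationSymmetry.vertDeriv bodyBundle (rotationConnection (R t) u) (R t) (v t)
          - bodyBundle.form (R t) (rotationSymmetry.hor rotationConnection (R t) u)
            (rotationSymmetry.gen (ξ t) (R t))) := by
  obtain ⟨x, rfl⟩ : ∃ x, u = R t * hat x := ⟨_, SO3_velocity (Eventually.of_forall hR) dR⟩
  have h1 : HasDerivAt (fun s => rotationTriv (R s) (ξ s) (v s))
      ((R t)ᵀ *ᵥ ξ' + (R t * hat x)ᵀ *ᵥ ξ t, v') t :=
    ((transposeL.hasFDerivAt.comp_hasDerivAt t dR).bilin mulVecL dξ).prodMk dv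
  rw [rotation_vertDeriv, rotation_hor (mem_tangentAt_SO3.2 ⟨hR t, x, rfl⟩), bodyForm_zero_left,
    sub_zero, sub_zero, rotationConnection_tangent (hR t), dξ.deriv]
  refine ((add_zero _).trans h1.deriv).trans (Prod.ext ?_ ((add_zero _).trans dv.deriv).symm)
  change (R t)ᵀ *ᵥ ξ' + (R t * hat x)ᵀ *ᵥ ξ t = (R t)ᵀ *ᵥ (ξ' - (R t *ᵥ x) ⨯₃ ξ t)
  rw [Matrix.mulVec_sub, SO3_mulVec_cross (SO3_transpose (hR t)),
    SO3_transpose_mulVec_mulVec (hR t), Matrix.transpose_mul, hat_transpose,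
    ← Matrix.mulVec_mulVec, Matrix.neg_mulVec, hat_mulVec, sub_eq_add_neg]

lemma rotation_isReducedBundle : rotationSymmetry.IsReducedBundle bodyBundle rotationConnection
    (fun _ => PUnit.unit.{1}) rotationTriv pointBundle where
  form R _ u hu w hw := by
    rw [curvature_eq_zero _ _ (rotation_hor hu) (rotation_hor hw), rotation_hor hu,
      bodyForm_zero_left, rotationTriv, Matrix.mulVec_zero]
    rfl
  bracket R hR ξ₁ ξ₂ v₁ v₂ := by
    -- With vanishing vertical derivatives and fibre bracket, the second component of the reduced
    -- bracket is `-ω` of the generators. The reversed order in the two-form turns it into `Ω₁ ×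
    -- Ω₂`, equal to the first component.
    have hf : bodyBundle.form R (rotationSymmetry.gen ξ₁ R) (rotationSymmetry.gen ξ₂ R)
        = (Rᵀ *ᵥ ξ₂) ⨯₃ (Rᵀ *ᵥ ξ₁) := by
      rw [← bodyVel_rotation_gen hR, ← bodyVel_rotation_gen hR]; rfl
    have hb : bodyBundle.bracket R v₁ v₂ = 0 := rfl
    rw [rotation_vertDeriv, rotation_vertDeriv, hf, hb, add_zero, sub_zero, zero_sub,
      cross_anticomm]
    exact Prod.ext (SO3_mulVec_cross (SO3_transpose hR) _ _).symm rfl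
  conn R ξ v hR hξ hv t := by
    have dR : HasDerivAt R (deriv R t) t :=
      ((contDiffOn_univ.1 hR.1).differentiable (by simp) t).hasDerivAt
    exact rotation_covDeriv (fun s => hR.2 s (Set.mem_univ _)) dR
      (hξ.differentiable (by simp) t).hasDerivAt (hv.differentiable (by simp) t).hasDerivAt

lemma rotation_isReducedLagrangian (I K : M3) :
    rotationSymmetry.IsReducedLagrangian bodyBundle rotationConnection
      (fun _ => PUnit.unit.{1}) rotationTriv (bodyLagrangian I K) (pointLagrangian I K) where
  invariant g hg R _ u _ v := by
    rw [rotation_tangentAct, bodyLagrangian, bodyLagrangian]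
    have h : bodyVel (rotationSymmetry.act g R) (g * u) = bodyVel R u := bodyVel_mul_left hg R u
    rw [h]
    rfl
  reduced R _ u hu v := by
    rw [rotationTriv_rotationConnection hu]
    rfl

lemma rotation_isReductionStep (I K : M3) :
    rotationSymmetry.IsReductionStep bodyBundle (bodyLagrangian I K) rotationConnection
      (fun _ => PUnit.unit.{1}) rotationTriv pointBundle (pointLagrangian I K) where
  lieGroup := rotation_isLieGroup
  source := bodyBundle_isLP
  action := rotation_isLPAction
  quotient := rotation_isQuotientMap
  connection := rotation_isPrincipalConnection
  trivialization := rotation_isTrivialization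
  ident := rotation_isIdentification
  bundle := rotation_isReducedBundle
  target := pointBundle_isLP
  lagrangian := rotation_isReducedLagrangian I K

end Rotation

/-! ### Derivatives along curves and variations -/

lemma dotProduct_left_ext_iff {a b : V3} : (∀ w : V3, w ⬝ᵥ a = w ⬝ᵥ b) ↔ a = b :=
  ⟨fun h => by ext i; simpa using h (Pi.single i 1), fun h _ => by rw [h]⟩

lemma HasDerivAt.dot {x y : ℝ → V3} {x' y' : V3} {t : ℝ} (K : M3) (hx : HasDerivAt x x' t)
    (hy : HasDerivAt y y' t) :
    HasDerivAt (fun s => x s ⬝ᵥ (K *ᵥ y s)) (x' ⬝ᵥ (K *ᵥ y t) + x t ⬝ᵥ (K *ᵥ y')) t := by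
  simpa [add_comm] using hx.bilin (quadL K) hy

lemma HasDerivAt.half_quad {K : M3} (hK : K.PosDef) {x : ℝ → V3} {x' : V3} {t : ℝ}
    (hx : HasDerivAt x x' t) :
    HasDerivAt (fun s => (1 / 2) * (x s ⬝ᵥ (K *ᵥ x s))) (x' ⬝ᵥ (K *ᵥ x t)) t := by
  refine ((hx.dot K hx).const_mul (1 / 2 : ℝ)).congr_deriv ?_
  rw [hK.quad_comm (x t) x']; ring

lemma hasDerivAt_add_smul {E : Type*} [NormedAddCommGroup E] [NormedSpace ℝ E] (u w : E) :
    HasDerivAt (fun s : ℝ => u + s • w) w 0 := by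
  simpa using ((hasDerivAt_id (0 : ℝ)).smul_const w).const_add u

lemma HasDerivAt.bodyVel {R U : ℝ → M3} {R' U' : M3} {t : ℝ} (hR : HasDerivAt R R' t)
    (hU : HasDerivAt U U' t) :
    HasDerivAt (fun s => bodyVel (R s) (U s)) (bodyVel (R t) U' + bodyVel R' (U t)) t :=
  hR.bilin bodyVelL hU

lemma HasDerivAt.rotorVel {z w : ℝ → Fin 3 → ℂ} {z' w' : Fin 3 → ℂ} {t : ℝ}
    (hz : HasDerivAt z z' t) (hw : HasDerivAt w w' t) :
    HasDerivAt (fun s => rotorVel (z s) (w s)) (rotorVel (z t) w' + rotorVel z' (w t)) t :=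
  hz.bilin rotorVelL hw

lemma hasDerivAt_bodyVel_add_smul (R u w : M3) :
    HasDerivAt (fun s : ℝ => bodyVel R (u + s • w)) (bodyVel R w) 0 :=
  (bodyVelL R).hasFDerivAt.comp_hasDerivAt 0 (hasDerivAt_add_smul u w)

section Variation

variable {E : Type*} [NormedAddCommGroup E] [NormedSpace ℝ E] {M : Set E} {J : Set ℝ}
  {q : ℝ → E} {c : ℝ → ℝ → E} {t : ℝ}

lemma IsSmoothCurve.hasDerivAt (hJ : IsOpen J) (hq : IsSmoothCurve M J q) (ht : t ∈ J) :
    HasDerivAt q (deriv q t) t :=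
  ((hq.1.differentiableOn (by simp)).differentiableAt (hJ.mem_nhds ht)).hasDerivAt

lemma IsSmoothCurve.hasDerivAt_deriv (hJ : IsOpen J) (hq : IsSmoothCurve M J q) (ht : t ∈ J) :
    HasDerivAt (deriv q) (deriv (deriv q) t) t :=
  (((hq.1.deriv_of_isOpen hJ (m := 1) two_le_infty).differentiableOn (by simp)).differentiableAt
    (hJ.mem_nhds ht)).hasDerivAt

lemma IsSmoothCurve.eventually_mem (hJ : IsOpen J) (hq : IsSmoothCurve M J q) (ht : t ∈ J) :
    ∀ᶠ s in 𝓝 t, q s ∈ M :=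
  (hJ.eventually_mem ht).mono hq.2

/-- The first and mixed second derivatives of a variation. -/
lemma IsVariation.hasDerivAt (hJ : IsOpen J) (hc : IsVariation M J q c) (ht : t ∈ J) :
    HasDerivAt (fun ε => c t ε) (infVar c t) 0 ∧
    (fun ε => deriv (fun s => c s ε) t) 0 = deriv q t ∧
    ∃ W, HasDerivAt (fun ε => deriv (fun s => c s ε) t) W 0 ∧ HasDerivAt (infVar c) W t := by
  set F : ℝ × ℝ → E := fun p => c p.1 p.2
  have hF : ∀ s ∈ J, ∀ ε, ContDiffAt ℝ ∞ F (s, ε) := fun s hs ε =>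
    hc.smooth.contDiffAt ((hJ.prod isOpen_univ).mem_nhds ⟨hs, Set.mem_univ _⟩)
  have dF : ∀ s ∈ J, ∀ ε, HasFDerivAt F (fderiv ℝ F (s, ε)) (s, ε) := fun s hs ε =>
    ((hF s hs ε).differentiableAt (by simp)).hasFDerivAt
  have d1 : ∀ s ∈ J, ∀ ε, HasDerivAt (fun r => c r ε) (fderiv ℝ F (s, ε) (1, 0)) s :=
    fun s hs ε => HasFDerivAt.comp_hasDerivAt (l := F) (f := fun r => (r, ε)) s (dF s hs ε)
      ((hasDerivAt_id s).prodMk (hasDerivAt_const s ε))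
  have d2 : ∀ s ∈ J, ∀ ε, HasDerivAt (fun r => c s r) (fderiv ℝ F (s, ε) (0, 1)) ε :=
    fun s hs ε => HasFDerivAt.comp_hasDerivAt (l := F) (f := fun r => (s, r)) ε (dF s hs ε)
      ((hasDerivAt_const ε s).prodMk (hasDerivAt_id ε))
  have dd : HasFDerivAt (fderiv ℝ F) (fderiv ℝ (fderiv ℝ F) (t, 0)) (t, 0) :=
    (((hF t ht 0).fderiv_right (m := 1) two_le_infty).differentiableAt (by simp)).hasFDerivAt
  refine ⟨(d2 t ht 0).differentiableAt.hasDerivAt, ?_, fderiv ℝ (fderiv ℝ F) (t, 0) (0, 1) (1, 0),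
    ?_, ?_⟩
  · exact Filter.EventuallyEq.deriv_eq ((hJ.eventually_mem ht).mono fun s hs => hc.init s hs)
  · have h := (ContinuousLinearMap.apply ℝ E ((1, 0) : ℝ × ℝ)).hasFDerivAt.comp_hasDerivAt 0
      (HasFDerivAt.comp_hasDerivAt (l := fderiv ℝ F) (f := fun ε : ℝ => (t, ε)) 0 dd
        ((hasDerivAt_const (0 : ℝ) t).prodMk (hasDerivAt_id (0 : ℝ))))
    exact h.congr_of_eventuallyEq (Eventually.of_forall fun ε => (d1 t ht ε).deriv)
  -- Equality of mixed partial derivatives allows the same `W` to serve for both orders of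
  -- differentiation.
  · have hsymm := ((hF t ht 0).isSymmSndFDerivAt
      (by rw [minSmoothness_of_isRCLikeNormedField]; exact two_le_infty)).eq (0, 1) (1, 0)
    rw [hsymm]
    have h := (ContinuousLinearMap.apply ℝ E ((0, 1) : ℝ × ℝ)).hasFDerivAt.comp_hasDerivAt t
      (HasFDerivAt.comp_hasDerivAt (l := fderiv ℝ F) (f := fun s : ℝ => (s, (0 : ℝ))) t dd
        ((hasDerivAt_id t).prodMk (hasDerivAt_const t (0 : ℝ))))
    exact h.congr_of_eventuallyEq ((hJ.eventually_mem ht).mono fun s hs => (d2 s hs 0).deriv)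

end Variation

/-! ### The Lagrange-Poincaré equations of the first reduced system -/

section Equations

variable {I K : M3} {J : Set ℝ} {t : ℝ}

lemma fibDeriv_body (hK : K.PosDef) (R u : M3) (η w : V3) :
    fibDeriv (bodyLagrangian I K) R u η w = w ⬝ᵥ (K *ᵥ η) := by
  have h := ((hasDerivAt_add_smul η w).half_quad hK).const_add
    ((1 / 2) * (bodyVel R u ⬝ᵥ (I *ᵥ bodyVel R u)))
  refine h.deriv.trans ?_
  simp

lemma velDeriv_body (hI : I.PosDef) (R u : M3) (η : V3) (w : M3) :
    velDeriv (bodyLagrangian I K) R u η w = bodyVel R w ⬝ᵥ (I *ᵥ bodyVel R u) := by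
  have h := ((hasDerivAt_bodyVel_add_smul R u w).half_quad hI).add_const
    ((1 / 2) * (η ⬝ᵥ (K *ᵥ η)))
  refine h.deriv.trans ?_
  simp

/-- With trivial bracket and connection the vertical equation is a conservation law for the momentum
`Kη`. -/
lemma verticalLP_body_iff (hK : K.PosDef) {R : ℝ → M3} {η : ℝ → V3}
    (hη : ∀ t ∈ J, DifferentiableAt ℝ η t) :
    VerticalLP bodyBundle (bodyLagrangian I K) J R η ↔ ∀ t ∈ J, K *ᵥ deriv η t = 0 := by
  refine forall₂_congr fun t ht => ?_
  have key : ∀ w, VerticalLPAt bodyBundle (bodyLagrangian I K) R η t w ↔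
      w ⬝ᵥ (K *ᵥ deriv η t) = w ⬝ᵥ (0 : V3) := fun w => by
    have h1 : LPBundle.covDeriv bodyBundle R (fun _ => w) t = 0 :=
      (add_zero _).trans (deriv_const t w)
    have h2 : bodyBundle.bracket (R t) (η t) w = 0 := rfl
    have h3 := ((hasDerivAt_const t w).dot K (hη t ht).hasDerivAt).deriv
    simp only [zero_dotProduct, zero_add] at h3
    rw [VerticalLPAt, h1, h2]
    simp only [fibDeriv_body hK, h3, zero_dotProduct, dotProduct_zero, sub_zero]
  exact (forall_congr' key).trans dotProduct_left_ext_iff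

lemma triple_swap (a b c : V3) : (a ⨯₃ b) ⬝ᵥ c = b ⬝ᵥ (c ⨯₃ a) := by
  rw [dotProduct_comm, triple_product_permutation, triple_product_permutation]

/-- The variation of the body angular velocity is `δΩ = σ' + Ω × σ`, where `σ` is the body
velocity of the infinitesimal variation. -/
lemma hasDerivAt_bodyVel_variation {R C U V : ℝ → M3} {R' D W : M3} {Ω σ : V3}
    (hR : HasDerivAt R R' t) (hRm : ∀ᶠ s in 𝓝 t, R s ∈ SO3) (hV : HasDerivAt V W t)
    (hVt : V t = D) (hC : HasDerivAt C D 0) (hCm : ∀ ε, C ε ∈ SO3) (hC0 : C 0 = R t)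
    (hU : HasDerivAt U W 0) (hU0 : U 0 = R') (hΩ : Ω = bodyVel (R t) R')
    (hσ : σ = bodyVel (R t) D) :
    ∃ σ', HasDerivAt (fun s => bodyVel (R s) (V s)) σ' t ∧
      HasDerivAt (fun ε => bodyVel (C ε) (U ε)) (σ' + Ω ⨯₃ σ) 0 := by
  -- The two derivatives share the term in `W`. They differ by exchanging `R'` and `D` in the
  -- base-point term, and that difference is the commutator `Ω × σ`.
  refine ⟨_, hR.bodyVel hV, (hC.bodyVel hU).congr_deriv ?_⟩
  have h1 := SO3_velocity hRm hR
  have h2 := SO3_velocity (Eventually.of_forall hCm) hC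
  rw [hC0] at h2
  rw [hC0, hU0, hVt, hΩ, hσ, ← bodyVel_mul_hat_sub hRm.self_of_nhds, ← h1, ← h2]
  abel

/-- The torus is abelian, so the variation of the rotor velocity is just the time derivative of the
infinitesimal variation. -/
lemma hasDerivAt_rotorVel_variation {z C U V : ℝ → Fin 3 → ℂ} {z' D W : Fin 3 → ℂ}
    (hz : HasDerivAt z z' t) (hzm : ∀ᶠ s in 𝓝 t, z s ∈ T3) (hV : HasDerivAt V W t)
    (hVt : V t = D) (hC : HasDerivAt C D 0) (hCm : ∀ ε, C ε ∈ T3) (hC0 : C 0 = z t)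
    (hU : HasDerivAt U W 0) (hU0 : U 0 = z') :
    ∃ σ', HasDerivAt (fun s => rotorVel (z s) (V s)) σ' t ∧
      HasDerivAt (fun ε => rotorVel (C ε) (U ε)) σ' 0 := by
  refine ⟨_, hz.rotorVel hV, (hC.rotorVel hU).congr_deriv ?_⟩
  have h1 := T3_velocity hzm hz
  have h2 := T3_velocity (Eventually.of_forall hCm) hC
  rw [hC0] at h2
  rw [hC0, hU0, hVt, h1, h2, rotorVel_imag_imag, rotorVel_imag_imag]

lemma hasDerivAt_bodyVel_deriv (hJ : IsOpen J) {R : ℝ → M3} {Ω : ℝ → V3}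
    (hR : IsSmoothCurve SO3 J R) (hΩ : ∀ t ∈ J, Ω t = bodyVel (R t) (deriv R t)) (ht : t ∈ J) :
    HasDerivAt Ω (deriv Ω t) t :=
  (((hR.hasDerivAt hJ ht).bodyVel (hR.hasDerivAt_deriv hJ ht)).congr_of_eventuallyEq
    ((hJ.eventually_mem ht).mono hΩ)).differentiableAt.hasDerivAt

/-- The terms in `σ'` cancel between the variation of the Lagrangian and the time derivative of the
momentum. There remains `(Ω × σ) ⬝ IΩ - σ ⬝ IΩ'`, and the triple product isolates `σ`. -/
lemma eulerOperator_body (hI : I.PosDef) (hJ : IsOpen J) {R : ℝ → M3} {η Ω : ℝ → V3}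
    (hR : IsSmoothCurve SO3 J R) (hΩ : ∀ t ∈ J, Ω t = bodyVel (R t) (deriv R t))
    {c : ℝ → ℝ → M3} (hc : IsVariation SO3 J R c) (ht : t ∈ J) :
    eulerOperator bodyBundle (bodyLagrangian I K) R η c t
      = bodyVel (R t) (infVar c t) ⬝ᵥ ((I *ᵥ Ω t) ⨯₃ Ω t - I *ᵥ deriv Ω t) := by
  obtain ⟨hδ, hu, W, hW, hW'⟩ := hc.hasDerivAt hJ ht
  have dΩ := hasDerivAt_bodyVel_deriv hJ hR hΩ ht
  obtain ⟨σ', dσ, dω⟩ := hasDerivAt_bodyVel_variation (hR.hasDerivAt hJ ht)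
    (hR.eventually_mem hJ ht) hW' rfl hδ (fun ε => hc.mem t ht ε) (hc.init t ht) hW hu (hΩ t ht) rfl
  have h0 : bodyVel (c t 0) (deriv (fun s => c s 0) t) = Ω t := by
    rw [hΩ t ht, hc.init t ht]
    exact congrArg (bodyVel (R t)) hu
  have h1 : HasDerivAt (fun ε : ℝ => bodyLagrangian I K (c t ε) (deriv (fun s => c s ε) t)
      (η t - ε • (0 : V3))) ((σ' + Ω t ⨯₃ bodyVel (R t) (infVar c t)) ⬝ᵥ (I *ᵥ Ω t)) 0 := by
    simp only [smul_zero, sub_zero]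
    exact ((dω.half_quad hI).add_const ((1 / 2) * (η t ⬝ᵥ (K *ᵥ η t)))).congr_deriv
      (congrArg (fun x => _ ⬝ᵥ (I *ᵥ x)) h0)
  have h2 : HasDerivAt (fun s => velDeriv (bodyLagrangian I K) (R s) (deriv R s) (η s)
      (infVar c s)) (σ' ⬝ᵥ (I *ᵥ Ω t) + bodyVel (R t) (infVar c t) ⬝ᵥ (I *ᵥ deriv Ω t)) t := by
    simp only [velDeriv_body hI]
    exact (dσ.dot I dΩ).congr_of_eventuallyEq
      ((hJ.eventually_mem ht).mono fun s hs => congrArg (fun x => _ ⬝ᵥ (I *ᵥ x)) (hΩ s hs).symm)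
  refine (congrArg₂ (· - ·) h1.deriv h2.deriv).trans ?_
  simp only [add_dotProduct, triple_swap, dotProduct_sub]
  ring

/-- A variation whose infinitesimal body velocity is the constant `y`. The equation is tested
pointwise in time and endpoints are free, so these variations suffice. -/
lemma isVariation_exp {R : ℝ → M3} (hR : IsSmoothCurve SO3 J R) (y : V3) :
    IsVariation SO3 J R (fun t ε => R t * NormedSpace.exp (ε • hat y)) where
  smooth := (hR.1.comp contDiffOn_fst fun _ hp => hp.1).mul
    ((contDiff_exp_smul (hat y)).comp contDiff_snd).contDiffOn
  mem t ht ε := SO3_mul (hR.2 t ht) (exp_mem_SO3 (by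
    rw [Matrix.transpose_smul, hat_transpose, smul_neg]))
  init t _ := by simp

lemma infVar_exp (R : ℝ → M3) (y : V3) :
    infVar (fun t ε => R t * NormedSpace.exp (ε • hat y)) t = R t * hat y :=
  ((hasDerivAt_exp_smul_zero (hat y)).const_mul (R t)).deriv

lemma horizontalLP_body_iff (hI : I.PosDef) (hK : K.PosDef) (hJ : IsOpen J) {R : ℝ → M3}
    {η Ω : ℝ → V3} (hR : IsSmoothCurve SO3 J R) (hΩ : ∀ t ∈ J, Ω t = bodyVel (R t) (deriv R t)) :
    HorizontalLP bodyBundle (bodyLagrangian I K) J R η ↔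
      ∀ t ∈ J, I *ᵥ deriv Ω t = (I *ᵥ Ω t) ⨯₃ Ω t + (K *ᵥ η t) ⨯₃ Ω t := by
  have key : ∀ c, IsVariation SO3 J R c → ∀ t ∈ J,
      (eulerOperator bodyBundle (bodyLagrangian I K) R η c t
        = fibDeriv (bodyLagrangian I K) (R t) (deriv R t) (η t)
          (bodyBundle.form (R t) (deriv R t) (infVar c t)) ↔
      bodyVel (R t) (infVar c t) ⬝ᵥ (I *ᵥ deriv Ω t)
        = bodyVel (R t) (infVar c t) ⬝ᵥ ((I *ᵥ Ω t) ⨯₃ Ω t + (K *ᵥ η t) ⨯₃ Ω t)) := by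
    intro c hc t ht
    -- The curvature force is `⟨Kη, σ × Ω⟩ = -⟨σ, Kη × Ω⟩`, the source of the gyroscopic term.
    have hf : bodyBundle.form (R t) (deriv R t) (infVar c t)
        = bodyVel (R t) (infVar c t) ⨯₃ Ω t := by rw [hΩ t ht]; rfl
    rw [eulerOperator_body hI hJ hR hΩ hc ht, fibDeriv_body hK, hf, ← cross_anticomm (Ω t) (bodyVel (R t) (infVar c t)),
      neg_dotProduct, triple_swap, dotProduct_sub, dotProduct_add]
    constructor <;> intro h <;> linarith
  constructor
  · intro h t ht
    refine dotProduct_left_ext_iff.1 fun y => ?_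
    have hv := isVariation_exp hR y
    have h1 := (key _ hv t ht).1 (h _ hv t ht)
    rwa [infVar_exp, bodyVel_mul_hat (hR.2 t ht)] at h1
  · intro h c hc t ht
    exact (key c hc t ht).2 (by rw [h t ht])

/-! ### The Euler-Lagrange equations of the original system -/

lemma velDeriv_rotor (hI : I.PosDef) (hK : K.PosDef) (q u w : M3 × (Fin 3 → ℂ)) (v : PUnit.{1}) :
    velDeriv (rotorLagrangian I K) q u v w = bodyVel q.1 w.1 ⬝ᵥ (I *ᵥ bodyVel q.1 u.1)
      + (bodyVel q.1 w.1 + rotorVel q.2 w.2) ⬝ᵥ (K *ᵥ torusConnection q u) := by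
  have h1 := hasDerivAt_bodyVel_add_smul q.1 u.1 w.1
  have h2 : HasDerivAt (fun s : ℝ => rotorVel q.2 (u.2 + s • w.2)) (rotorVel q.2 w.2) 0 :=
    (rotorVelL q.2).hasFDerivAt.comp_hasDerivAt 0 (hasDerivAt_add_smul u.2 w.2)
  refine ((h1.half_quad hI).add ((h1.add h2).half_quad hK)).deriv.trans ?_
  simp [torusConnection]

/-- Here `Kη` is paired with the variation of `Ω + Ω_r`. The term `Kη × Ω` thus comes from the
bracket in `δΩ`, whereas after reduction it comes from the curvature. -/
lemma eulerOperator_rotor (hI : I.PosDef) (hK : K.PosDef) (hJ : IsOpen J)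
    {q : ℝ → M3 × (Fin 3 → ℂ)} {Ω η : ℝ → V3}
    (hq : IsSmoothCurve (SO3 ×ˢ T3) J q) (hΩ : ∀ t ∈ J, Ω t = bodyVel (q t).1 (deriv q t).1)
    (hη : ∀ t ∈ J, η t = torusConnection (q t) (deriv q t))
    {c : ℝ → ℝ → M3 × (Fin 3 → ℂ)} (hc : IsVariation (SO3 ×ˢ T3) J q c) (ht : t ∈ J)
    (v : ℝ → PUnit.{1}) :
    eulerOperator rotorBundle (rotorLagrangian I K) q v c t
      = bodyVel (q t).1 (infVar c t).1 ⬝ᵥ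
          ((I *ᵥ Ω t) ⨯₃ Ω t + (K *ᵥ η t) ⨯₃ Ω t - I *ᵥ deriv Ω t - K *ᵥ deriv η t)
        - rotorVel (q t).2 (infVar c t).2 ⬝ᵥ (K *ᵥ deriv η t) := by
  obtain ⟨hδ, hu, W, hW, hW'⟩ := hc.hasDerivAt hJ ht
  have hd := hq.hasDerivAt hJ ht
  have hdd := hq.hasDerivAt_deriv hJ ht
  have hm := hq.eventually_mem hJ ht
  have hd1 : HasDerivAt (fun s => (q s).1) (deriv q t).1 t := hd.fst
  have hd2 : HasDerivAt (fun s => (q s).2) (deriv q t).2 t := hd.snd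
  have hdd1 : HasDerivAt (fun s => (deriv q s).1) (deriv (deriv q) t).1 t := hdd.fst
  have hdd2 : HasDerivAt (fun s => (deriv q s).2) (deriv (deriv q) t).2 t := hdd.snd
  have dΩ : HasDerivAt Ω (deriv Ω t) t :=
    ((hd1.bodyVel hdd1).congr_of_eventuallyEq
      ((hJ.eventually_mem ht).mono hΩ)).differentiableAt.hasDerivAt
  have dη : HasDerivAt η (deriv η t) t :=
    (((hd1.bodyVel hdd1).add (hd2.rotorVel hdd2)).congr_of_eventuallyEq
      ((hJ.eventually_mem ht).mono hη)).differentiableAt.hasDerivAt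
  obtain ⟨σ', dσ, dω⟩ := hasDerivAt_bodyVel_variation hd.fst (hm.mono fun s hs => hs.1) hW'.fst
    rfl hδ.fst (fun ε => (hc.mem t ht ε).1) (congrArg Prod.fst (hc.init t ht)) hW.fst
    (congrArg Prod.fst hu) (hΩ t ht) rfl
  obtain ⟨τ', dτ, dρ⟩ := hasDerivAt_rotorVel_variation hd.snd (hm.mono fun s hs => hs.2) hW'.snd
    rfl hδ.snd (fun ε => (hc.mem t ht ε).2) (congrArg Prod.snd (hc.init t ht)) hW.snd
    (congrArg Prod.snd hu)
  have h0 : bodyVel (c t 0).1 (deriv (fun s => c s 0) t).1 = Ω t := by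
    rw [hΩ t ht, hc.init t ht]
    exact congrArg (fun u => bodyVel (q t).1 u.1) hu
  have h0' : bodyVel (c t 0).1 (deriv (fun s => c s 0) t).1
      + rotorVel (c t 0).2 (deriv (fun s => c s 0) t).2 = η t := by
    rw [hη t ht, hc.init t ht]
    exact congrArg (torusConnection (q t)) hu
  set σ := bodyVel (q t).1 (infVar c t).1
  set τ := rotorVel (q t).2 (infVar c t).2
  have h1 : HasDerivAt (fun ε : ℝ => rotorLagrangian I K (c t ε) (deriv (fun s => c s ε) t)
      (v t - ε • (0 : PUnit.{1}))) ((σ' + Ω t ⨯₃ σ) ⬝ᵥ (I *ᵥ Ω t)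
        + (σ' + Ω t ⨯₃ σ + τ') ⬝ᵥ (K *ᵥ η t)) 0 := by
    exact ((dω.half_quad hI).add ((dω.add dρ).half_quad hK)).congr_deriv
      (congrArg₂ (fun x y => _ ⬝ᵥ (I *ᵥ x) + _ ⬝ᵥ (K *ᵥ y)) h0 h0')
  have h2 : HasDerivAt (fun s => velDeriv (rotorLagrangian I K) (q s) (deriv q s) (v s)
      (infVar c s)) (σ' ⬝ᵥ (I *ᵥ Ω t) + σ ⬝ᵥ (I *ᵥ deriv Ω t)
        + ((σ' + τ') ⬝ᵥ (K *ᵥ η t) + (σ + τ) ⬝ᵥ (K *ᵥ deriv η t))) t := by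
    simp only [velDeriv_rotor hI hK]
    exact ((dσ.dot I dΩ).add ((dσ.add dτ).dot K dη)).congr_of_eventuallyEq
      ((hJ.eventually_mem ht).mono fun s hs =>
        congrArg₂ (fun x y => _ ⬝ᵥ (I *ᵥ x) + _ ⬝ᵥ (K *ᵥ y)) (hΩ s hs).symm (hη s hs).symm)
  refine (congrArg₂ (· - ·) h1.deriv h2.deriv).trans ?_
  simp only [add_dotProduct, triple_swap, dotProduct_sub, dotProduct_add]
  ring

lemma solvesLP_rotor_iff (hI : I.PosDef) (hK : K.PosDef) (hJ : IsOpen J)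
    {q : ℝ → M3 × (Fin 3 → ℂ)} {Ω η : ℝ → V3}
    (hq : IsSmoothCurve (SO3 ×ˢ T3) J q) (hΩ : ∀ t ∈ J, Ω t = bodyVel (q t).1 (deriv q t).1)
    (hη : ∀ t ∈ J, η t = torusConnection (q t) (deriv q t)) :
    SolvesLP rotorBundle (rotorLagrangian I K) J q (fun _ => PUnit.unit) ↔
      ∀ t ∈ J, I *ᵥ deriv Ω t = (I *ᵥ Ω t) ⨯₃ Ω t + (K *ᵥ η t) ⨯₃ Ω t ∧ K *ᵥ deriv η t = 0 := by
  have hf : ∀ q u v w, fibDeriv (rotorLagrangian I K) q u v w = 0 := fun q u v w =>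
    deriv_const _ _
  have hvert : VerticalLP rotorBundle (rotorLagrangian I K) J q (fun _ => PUnit.unit) := by
    intro t _ w
    simp only [VerticalLPAt, hf, deriv_const, sub_zero]
  rw [SolvesLP, and_iff_left hvert]
  constructor
  · intro h t ht
    -- The body and the rotors are varied independently. The choice `y = 0` gives `Kη' = 0`, which
    -- then removes the extra `Kη'` from the equation tested by `y`.
    have hvar : ∀ y b : V3, y ⬝ᵥ
          ((I *ᵥ Ω t) ⨯₃ Ω t + (K *ᵥ η t) ⨯₃ Ω t - I *ᵥ deriv Ω t - K *ᵥ deriv η t)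
        - b ⬝ᵥ (K *ᵥ deriv η t) = 0 := by
      intro y b
      have hR : IsSmoothCurve SO3 J (fun t => (q t).1) :=
        ⟨hq.1.fst, fun t ht => (hq.2 t ht).1⟩
      have hy := isVariation_exp hR y
      have hc : IsVariation (SO3 ×ˢ T3) J q (fun t ε =>
          ((q t).1 * NormedSpace.exp (ε • hat y), NormedSpace.exp (ε • imag b) * (q t).2)) :=
        { smooth := hy.smooth.prodMk ((((contDiff_exp_smul (imag b)).comp
            contDiff_snd).contDiffOn).mul (hq.1.snd.comp contDiffOn_fst fun _ hp => hp.1))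
          mem := fun t ht ε => ⟨hy.mem t ht ε, T3_mul
            (by rw [← imag_smul]; exact exp_imag_mem_T3 _) (hq.2 t ht).2⟩
          init := fun t _ => by simp }
      have hi : infVar (fun t ε => ((q t).1 * NormedSpace.exp (ε • hat y),
          NormedSpace.exp (ε • imag b) * (q t).2)) t = ((q t).1 * hat y, imag b * (q t).2) :=
        (((hasDerivAt_exp_smul_zero (hat y)).const_mul (q t).1).prodMk
          ((hasDerivAt_exp_smul_zero (imag b)).mul_const (q t).2)).deriv
      have h1 := (eulerOperator_rotor hI hK hJ hq hΩ hη hc ht _).symm.trans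
        ((h _ hc t ht).trans (hf _ _ _ _))
      rwa [hi, bodyVel_mul_hat (hq.2 t ht).1, rotorVel_imag_mul (hq.2 t ht).2] at h1
    have h2 : K *ᵥ deriv η t = 0 := dotProduct_left_ext_iff.1 fun b => by
      simpa using hvar 0 b
    refine ⟨dotProduct_left_ext_iff.1 fun y => ?_, h2⟩
    have h3 := hvar y 0
    rw [h2, sub_zero, zero_dotProduct, sub_zero, dotProduct_sub] at h3
    linarith
  · intro h c hc t ht
    refine (eulerOperator_rotor hI hK hJ hq hΩ hη hc ht _).trans (Eq.trans ?_ (hf _ _ _ _).symm)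
    rw [(h t ht).2, (h t ht).1]
    simp

end Equations

/-! ### The second reduced system and the Euler-Poincaré equations -/

section Point

variable {I K : M3} {J : Set ℝ} {t : ℝ}

lemma fibDeriv_point (hI : I.PosDef) (hK : K.PosDef) (x u : PUnit.{1}) (a w : V3 × V3) :
    fibDeriv (pointLagrangian I K) x u a w = w.1 ⬝ᵥ (I *ᵥ a.1) + w.2 ⬝ᵥ (K *ᵥ a.2) := by
  refine (((hasDerivAt_add_smul a.1 w.1).half_quad hI).add
    ((hasDerivAt_add_smul a.2 w.2).half_quad hK)).deriv.trans ?_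
  simp

lemma fibDeriv_ep (hI : I.PosDef) (hK : K.PosDef) (x u : PUnit.{1}) (a w : V3 × V3) :
    fibDeriv (epLagrangian I K) x u a w
      = w.1 ⬝ᵥ ((I + K) *ᵥ a.1 + K *ᵥ a.2) + w.2 ⬝ᵥ (K *ᵥ a.2 + K *ᵥ a.1) := by
  have h1 := hasDerivAt_add_smul a.1 w.1
  have h2 := hasDerivAt_add_smul a.2 w.2
  refine (((h1.half_quad (hI.add hK)).add (h2.half_quad hK)).add (h1.dot K h2)).deriv.trans ?_
  simp only [zero_smul, add_zero, dotProduct_add, hK.quad_comm a.1 w.2]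
  ring

/-- The bracket with `w` depends on `w.1` only, and its repeated component lets both momenta `IΩ`
and `Kη` act on that entry. So `w.2` tests a conservation law, and `w.1` tests the body equation. -/
lemma verticalLPAt_point_iff (hI : I.PosDef) (hK : K.PosDef) {Ω η : ℝ → V3}
    (hΩ : DifferentiableAt ℝ Ω t) (hη : DifferentiableAt ℝ η t) (w : V3 × V3) :
    VerticalLPAt pointBundle (pointLagrangian I K) (fun _ => PUnit.unit) (fun s => (Ω s, η s)) t w ↔
      w.1 ⬝ᵥ (I *ᵥ deriv Ω t) + w.2 ⬝ᵥ (K *ᵥ deriv η t)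
        = w.1 ⬝ᵥ ((I *ᵥ Ω t) ⨯₃ Ω t + (K *ᵥ η t) ⨯₃ Ω t) := by
  have h1 : LPBundle.covDeriv pointBundle (fun _ => PUnit.unit) (fun _ => w) t = 0 :=
    (add_zero _).trans (deriv_const t w)
  have h2 := (((hasDerivAt_const t w.1).dot I hΩ.hasDerivAt).add
    ((hasDerivAt_const t w.2).dot K hη.hasDerivAt)).deriv
  have h3 : pointBundle.bracket PUnit.unit (Ω t, η t) w = (Ω t ⨯₃ w.1, Ω t ⨯₃ w.1) := rfl
  rw [VerticalLPAt, h1, h3]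
  simp only [fibDeriv_point hI hK]
  refine Eq.congr ?_ ?_
  · simp only [zero_dotProduct, zero_add] at h2
    simp only [Prod.fst_zero, Prod.snd_zero, zero_dotProduct, add_zero, sub_zero]
    exact h2
  · simp only [triple_swap, dotProduct_add]

lemma verticalLPAt_ep_iff (hI : I.PosDef) (hK : K.PosDef) {Ω Ωr : ℝ → V3}
    (hΩ : DifferentiableAt ℝ Ω t) (hΩr : DifferentiableAt ℝ Ωr t) (w : V3 × V3) :
    VerticalLPAt epBundle (epLagrangian I K) (fun _ => PUnit.unit) (fun s => (Ω s, Ωr s)) t w ↔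
      w.1 ⬝ᵥ ((I + K) *ᵥ deriv Ω t + K *ᵥ deriv Ωr t)
          + w.2 ⬝ᵥ (K *ᵥ deriv Ωr t + K *ᵥ deriv Ω t)
        = w.1 ⬝ᵥ (((I + K) *ᵥ Ω t + K *ᵥ Ωr t) ⨯₃ Ω t) := by
  have h1 : LPBundle.covDeriv epBundle (fun _ => PUnit.unit) (fun _ => w) t = 0 :=
    (add_zero _).trans (deriv_const t w)
  have c1 := hasDerivAt_const t w.1
  have c2 := hasDerivAt_const t w.2
  have h2 := (((c1.dot (I + K) hΩ.hasDerivAt).add (c1.dot K hΩr.hasDerivAt)).add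
    ((c2.dot K hΩr.hasDerivAt).add (c2.dot K hΩ.hasDerivAt))).deriv
  have h3 : epBundle.bracket PUnit.unit (Ω t, Ωr t) w = (Ω t ⨯₃ w.1, 0) := rfl
  rw [VerticalLPAt, h1, h3]
  simp only [fibDeriv_ep hI hK]
  refine Eq.congr ?_ ?_
  · simp only [zero_dotProduct, zero_add] at h2
    simp only [Prod.fst_zero, Prod.snd_zero, zero_dotProduct, add_zero, sub_zero, dotProduct_add]
    exact h2
  · simp only [triple_swap, zero_dotProduct, add_zero]

lemma forall_dot_pair_iff {a b c : V3} :
    (∀ w : V3 × V3, w.1 ⬝ᵥ a + w.2 ⬝ᵥ b = w.1 ⬝ᵥ c) ↔ a = c ∧ b = 0 := by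
  constructor
  · intro h
    exact ⟨dotProduct_left_ext_iff.1 fun w => by simpa using h (w, 0),
      dotProduct_left_ext_iff.1 fun w => by simpa using h (0, w)⟩
  · rintro ⟨rfl, rfl⟩ w
    simp

/-- Over a point there are no velocities or variations, so both sides vanish. -/
lemma horizontalLP_point (v : ℝ → V3 × V3) :
    HorizontalLP pointBundle (pointLagrangian I K) J (fun _ => PUnit.unit) v := by
  intro c _ t _
  have hv : ∀ x u a w, velDeriv (pointLagrangian I K) x u a w = 0 := fun x u a w =>
    deriv_const _ _
  have h1 : pointBundle.form PUnit.unit (deriv (fun _ : ℝ => PUnit.unit.{1}) t) (infVar c t) = 0 :=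
    rfl
  have h2 : ∀ x u a, fibDeriv (pointLagrangian I K) x u a 0 = 0 := fun x u a => by
    simp only [fibDeriv, smul_zero, add_zero]
    exact deriv_const _ _
  have h3 : ∀ q, pointBundle.conn q (infVar c t) (v t) = 0 := fun _ => rfl
  rw [h1, h2, eulerOperator]
  simp only [hv, h3, smul_zero, sub_zero, deriv_const]
  exact deriv_const _ _

/-- The body momentum `(I + K)Ω + KΩ_r` equals `IΩ + Kη`, so the right sides agree and the left
sides differ by `Kη'`, which the second equation sets to zero. -/
lemma reduced_iff_eulerPoincare (I K : M3) (Ω Ω' Ωr Ωr' η η' : V3) (hη : η = Ω + Ωr)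
    (hη' : η' = Ω' + Ωr') :
    (I *ᵥ Ω' = (I *ᵥ Ω) ⨯₃ Ω + (K *ᵥ η) ⨯₃ Ω ∧ K *ᵥ η' = 0) ↔
      (I + K) *ᵥ Ω' + K *ᵥ Ωr' = ((I + K) *ᵥ Ω + K *ᵥ Ωr) ⨯₃ Ω ∧ K *ᵥ Ωr' + K *ᵥ Ω' = 0 := by
  subst hη hη'
  have e : (I + K) *ᵥ Ω' + K *ᵥ Ωr' = I *ᵥ Ω' + K *ᵥ (Ω' + Ωr') := by
    rw [Matrix.add_mulVec, Matrix.mulVec_add]; abel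
  have e2 : ((I + K) *ᵥ Ω + K *ᵥ Ωr) ⨯₃ Ω = (I *ᵥ Ω) ⨯₃ Ω + (K *ᵥ (Ω + Ωr)) ⨯₃ Ω := by
    rw [← LinearMap.add_apply, ← map_add, Matrix.add_mulVec, Matrix.mulVec_add, add_assoc]
  rw [e, e2, add_comm (K *ᵥ Ωr'), ← Matrix.mulVec_add]
  constructor
  · rintro ⟨h1, h2⟩
    exact ⟨by rw [h1, h2, add_zero], h2⟩
  · rintro ⟨h1, h2⟩
    exact ⟨by rwa [h2, add_zero] at h1, h2⟩

lemma rotorLagrangian_eq_epLagrangian (hK : K.PosDef) (q u : M3 × (Fin 3 → ℂ)) (v : PUnit.{1}) :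
    rotorLagrangian I K q u v
      = epLagrangian I K PUnit.unit 0 (bodyVel q.1 u.1, rotorVel q.2 u.2) := by
  simp only [rotorLagrangian, epLagrangian, Matrix.add_mulVec, Matrix.mulVec_add, dotProduct_add,
    add_dotProduct, hK.quad_comm (rotorVel q.2 u.2) (bodyVel q.1 u.1)]
  ring

end Point

/-! ### Assembly of the two stages and comparison of all the equations. -/

theorem mainTheorem2 (I K : M3) (hI : I.PosDef) (hK : K.PosDef) :
    -- First stage: the mechanical connection and the reduction by the torus.
    torusSymmetry.IsMechanical (SO3 ×ˢ T3) (rotorMetric I K) torusConnection ∧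
    (∀ q u v, rotorLagrangian I K q u v = (1 / 2) * rotorMetric I K q u u) ∧
    torusSymmetry.IsReductionStep rotorBundle (rotorLagrangian I K) torusConnection Prod.fst
      torusTriv bodyBundle (bodyLagrangian I K) ∧
    (∀ q ∈ SO3 ×ˢ T3, ∀ u ∈ tangentAt (SO3 ×ˢ T3) q, ∀ w ∈ tangentAt (SO3 ×ˢ T3) q,
      torusSymmetry.curvature torusConnection q u w = bodyVel q.1 w.1 ⨯₃ bodyVel q.1 u.1) ∧
    -- The vertical and horizontal equations of the first stage.
    (∀ (t₀ t₁ : ℝ) (R : ℝ → M3) (η : ℝ → V3),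
      IsSmoothCurve SO3 (Set.Ioo t₀ t₁) R → ContDiffOn ℝ ∞ η (Set.Ioo t₀ t₁) →
      ∀ Ω : ℝ → V3, (∀ t, Ω t = bodyVel (R t) (deriv R t)) →
      (VerticalLP bodyBundle (bodyLagrangian I K) (Set.Ioo t₀ t₁) R η ↔
        ∀ t ∈ Set.Ioo t₀ t₁, K *ᵥ deriv η t = 0) ∧
      (HorizontalLP bodyBundle (bodyLagrangian I K) (Set.Ioo t₀ t₁) R η ↔
        ∀ t ∈ Set.Ioo t₀ t₁,
          I *ᵥ deriv Ω t = (I *ᵥ Ω t) ⨯₃ Ω t + (K *ᵥ η t) ⨯₃ Ω t)) ∧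
    -- Second stage: the reduction by the rotation group, to a bundle over a point.
    rotationSymmetry.IsReductionStep bodyBundle (bodyLagrangian I K) rotationConnection
      (fun _ => PUnit.unit) rotationTriv pointBundle (pointLagrangian I K) ∧
    (∀ R ∈ SO3, ∀ R' ∈ tangentAt SO3 R, ∀ η,
      rotationTriv R (rotationConnection R R') η = (bodyVel R R', η)) ∧
    -- The Euler-Poincaré Lagrangian is the invariant Lagrangian in the variables `(Ω, Ω_r)`.
    (∀ q u v, rotorLagrangian I K q u v
      = epLagrangian I K PUnit.unit 0 (bodyVel q.1 u.1, rotorVel q.2 u.2)) ∧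
    -- The equations of the second stage and the Euler-Poincaré equations.
    (∀ (t₀ t₁ : ℝ) (Ω η Ωr : ℝ → V3),
      ContDiffOn ℝ ∞ Ω (Set.Ioo t₀ t₁) → ContDiffOn ℝ ∞ η (Set.Ioo t₀ t₁) →
      (∀ t, η t = Ω t + Ωr t) →
      HorizontalLP pointBundle (pointLagrangian I K) (Set.Ioo t₀ t₁) (fun _ => PUnit.unit)
        (fun t => (Ω t, η t)) ∧
      (∀ t ∈ Set.Ioo t₀ t₁,
        ((∀ α, VerticalLPAt pointBundle (pointLagrangian I K) (fun _ => PUnit.unit)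
            (fun s => (Ω s, η s)) t (α, 0)) ↔
          I *ᵥ deriv Ω t = (I *ᵥ Ω t) ⨯₃ Ω t + (K *ᵥ η t) ⨯₃ Ω t) ∧
        ((∀ β, VerticalLPAt pointBundle (pointLagrangian I K) (fun _ => PUnit.unit)
            (fun s => (Ω s, η s)) t (0, β)) ↔
          K *ᵥ deriv η t = 0) ∧
        ((∀ w, VerticalLPAt pointBundle (pointLagrangian I K) (fun _ => PUnit.unit)
            (fun s => (Ω s, η s)) t w) ↔
          I *ᵥ deriv Ω t = (I *ᵥ Ω t) ⨯₃ Ω t + (K *ᵥ η t) ⨯₃ Ω t ∧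
          K *ᵥ deriv η t = 0) ∧
        ((∀ w, VerticalLPAt epBundle (epLagrangian I K) (fun _ => PUnit.unit)
            (fun s => (Ω s, Ωr s)) t w) ↔
          (I + K) *ᵥ deriv Ω t + K *ᵥ deriv Ωr t
              = ((I + K) *ᵥ Ω t + K *ᵥ Ωr t) ⨯₃ Ω t ∧
          K *ᵥ deriv Ωr t + K *ᵥ deriv Ω t = 0) ∧
        (((I *ᵥ deriv Ω t = (I *ᵥ Ω t) ⨯₃ Ω t + (K *ᵥ η t) ⨯₃ Ω t) ∧
            K *ᵥ deriv η t = 0) ↔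
          (I + K) *ᵥ deriv Ω t + K *ᵥ deriv Ωr t
              = ((I + K) *ᵥ Ω t + K *ᵥ Ωr t) ⨯₃ Ω t ∧
          K *ᵥ deriv Ωr t + K *ᵥ deriv Ω t = 0))) ∧
    -- The solutions of the original system and of all reduced systems correspond.
    (∀ (t₀ t₁ : ℝ) (q : ℝ → M3 × (Fin 3 → ℂ)), IsSmoothCurve (SO3 ×ˢ T3) (Set.Ioo t₀ t₁) q →
      ∀ Ω Ωr η : ℝ → V3, (∀ t, Ω t = bodyVel (q t).1 (deriv q t).1) →
      (∀ t, Ωr t = rotorVel (q t).2 (deriv q t).2) →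
      (∀ t, η t = torusConnection (q t) (deriv q t)) →
      (SolvesLP rotorBundle (rotorLagrangian I K) (Set.Ioo t₀ t₁) q (fun _ => PUnit.unit) ↔
        SolvesLP bodyBundle (bodyLagrangian I K) (Set.Ioo t₀ t₁) (fun t => (q t).1) η) ∧
      (SolvesLP bodyBundle (bodyLagrangian I K) (Set.Ioo t₀ t₁) (fun t => (q t).1) η ↔
        SolvesLP pointBundle (pointLagrangian I K) (Set.Ioo t₀ t₁) (fun _ => PUnit.unit)
          (fun t => (Ω t, η t))) ∧
      (SolvesLP pointBundle (pointLagrangian I K) (Set.Ioo t₀ t₁) (fun _ => PUnit.unit)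
          (fun t => (Ω t, η t)) ↔
        VerticalLP epBundle (epLagrangian I K) (Set.Ioo t₀ t₁) (fun _ => PUnit.unit)
          (fun t => (Ω t, Ωr t)))) := by
  have pair : ∀ {t : ℝ} {Ω η : ℝ → V3}, DifferentiableAt ℝ Ω t → DifferentiableAt ℝ η t →
      ((∀ w, VerticalLPAt pointBundle (pointLagrangian I K) (fun _ => PUnit.unit)
        (fun s => (Ω s, η s)) t w) ↔
      I *ᵥ deriv Ω t = (I *ᵥ Ω t) ⨯₃ Ω t + (K *ᵥ η t) ⨯₃ Ω t ∧ K *ᵥ deriv η t = 0) :=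
    fun hΩ hη => (forall_congr' (verticalLPAt_point_iff hI hK hΩ hη)).trans forall_dot_pair_iff
  have pairEP : ∀ {t : ℝ} {Ω Ωr : ℝ → V3}, DifferentiableAt ℝ Ω t → DifferentiableAt ℝ Ωr t →
      ((∀ w, VerticalLPAt epBundle (epLagrangian I K) (fun _ => PUnit.unit)
        (fun s => (Ω s, Ωr s)) t w) ↔
      (I + K) *ᵥ deriv Ω t + K *ᵥ deriv Ωr t = ((I + K) *ᵥ Ω t + K *ᵥ Ωr t) ⨯₃ Ω t ∧
        K *ᵥ deriv Ωr t + K *ᵥ deriv Ω t = 0) :=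
    fun hΩ hΩr => (forall_congr' (verticalLPAt_ep_iff hI hK hΩ hΩr)).trans forall_dot_pair_iff
  refine ⟨torus_isMechanical hI hK, ?_, torus_isReductionStep I K,
    fun q _ u hu w hw => torus_curvature hu hw, ?_, rotation_isReductionStep I K,
    fun R _ R' hR' η => rotationTriv_rotationConnection hR' η,
    fun q u v => rotorLagrangian_eq_epLagrangian hK q u v, ?_, ?_⟩
  · intro q u _
    simp only [rotorLagrangian, rotorMetric]
    ring
  · intro t₀ t₁ R η hR hη Ω hΩ
    exact ⟨verticalLP_body_iff hK fun t ht =>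
        (hη.differentiableOn (by simp)).differentiableAt (isOpen_Ioo.mem_nhds ht),
      horizontalLP_body_iff hI hK isOpen_Ioo hR fun t _ => hΩ t⟩
  · intro t₀ t₁ Ω η Ωr hΩ hη hsum
    refine ⟨horizontalLP_point _, fun t ht => ?_⟩
    have dΩ := (hΩ.differentiableOn (by simp)).differentiableAt (isOpen_Ioo.mem_nhds ht)
    have dη := (hη.differentiableOn (by simp)).differentiableAt (isOpen_Ioo.mem_nhds ht)
    -- Regularity of `Ωr` is inherited from `η` and `Ω`.
    have eΩr : Ωr = fun s => η s - Ω s := funext fun s => by rw [hsum]; abel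
    have dΩr : DifferentiableAt ℝ Ωr t := by rw [eΩr]; exact dη.sub dΩ
    have eη : deriv η t = deriv Ω t + deriv Ωr t := by
      rw [funext hsum]
      exact deriv_add dΩ dΩr
    refine ⟨?_, ?_, pair dΩ dη, pairEP dΩ dΩr,
      reduced_iff_eulerPoincare I K _ _ _ _ _ _ (hsum t) eη⟩
    · refine (forall_congr' fun α => verticalLPAt_point_iff hI hK dΩ dη (α, 0)).trans ?_
      simp only [zero_dotProduct, add_zero]
      exact dotProduct_left_ext_iff
    · refine (forall_congr' fun β => verticalLPAt_point_iff hI hK dΩ dη (0, β)).trans ?_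
      simp only [zero_dotProduct, zero_add]
      rw [← dotProduct_left_ext_iff]
      simp only [dotProduct_zero]
  · intro t₀ t₁ q hq Ω Ωr η hΩ hΩr hη
    have hJ : IsOpen (Set.Ioo t₀ t₁) := isOpen_Ioo
    have hR : IsSmoothCurve SO3 (Set.Ioo t₀ t₁) (fun t => (q t).1) :=
      ⟨hq.1.fst, fun t ht => (hq.2 t ht).1⟩
    -- The first component of `deriv q` is the derivative of the first component only where `q` is
    -- differentiable, hence the restriction to the interval.
    have hΩR : ∀ t ∈ Set.Ioo t₀ t₁,
        Ω t = bodyVel (q t).1 (deriv (fun t => (q t).1) t) := fun t ht => by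
      have h : HasDerivAt (fun t => (q t).1) (deriv q t).1 t := (hq.hasDerivAt hJ ht).fst
      exact (hΩ t).trans (congrArg (bodyVel (q t).1) h.deriv.symm)
    have dΩ : ∀ t ∈ Set.Ioo t₀ t₁, DifferentiableAt ℝ Ω t := fun t ht =>
      (hasDerivAt_bodyVel_deriv hJ hR hΩR ht).differentiableAt
    have dΩr : ∀ t ∈ Set.Ioo t₀ t₁, DifferentiableAt ℝ Ωr t := fun t ht => by
      have h1 : HasDerivAt (fun t => (q t).2) (deriv q t).2 t := (hq.hasDerivAt hJ ht).snd
      have h2 : HasDerivAt (fun t => (deriv q t).2) _ t := (hq.hasDerivAt_deriv hJ ht).snd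
      rw [funext hΩr]
      exact (h1.rotorVel h2).differentiableAt
    have hsum : ∀ t, η t = Ω t + Ωr t := fun t => by rw [hη, hΩ, hΩr]; rfl
    have dη : ∀ t ∈ Set.Ioo t₀ t₁, DifferentiableAt ℝ η t := fun t ht => by
      rw [funext hsum]; exact (dΩ t ht).add (dΩr t ht)
    have eη : ∀ t ∈ Set.Ioo t₀ t₁, deriv η t = deriv Ω t + deriv Ωr t := fun t ht => by
      rw [funext hsum]
      exact deriv_add (dΩ t ht) (dΩr t ht)
    -- The original and both reduced systems are each compared with the same pair of vector
    -- equations; their equivalences follow by transitivity.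
    have s0 := solvesLP_rotor_iff hI hK hJ hq (fun t _ => hΩ t) (fun t _ => hη t)
    have s1 : SolvesLP bodyBundle (bodyLagrangian I K) (Set.Ioo t₀ t₁) (fun t => (q t).1) η ↔
        ∀ t ∈ Set.Ioo t₀ t₁, I *ᵥ deriv Ω t = (I *ᵥ Ω t) ⨯₃ Ω t + (K *ᵥ η t) ⨯₃ Ω t ∧
          K *ᵥ deriv η t = 0 := by
      rw [SolvesLP, horizontalLP_body_iff hI hK hJ hR hΩR, verticalLP_body_iff hK dη]
      exact ⟨fun h t ht => ⟨h.1 t ht, h.2 t ht⟩,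
        fun h => ⟨fun t ht => (h t ht).1, fun t ht => (h t ht).2⟩⟩
    have s2 : SolvesLP pointBundle (pointLagrangian I K) (Set.Ioo t₀ t₁) (fun _ => PUnit.unit)
          (fun t => (Ω t, η t)) ↔
        ∀ t ∈ Set.Ioo t₀ t₁, I *ᵥ deriv Ω t = (I *ᵥ Ω t) ⨯₃ Ω t + (K *ᵥ η t) ⨯₃ Ω t ∧
          K *ᵥ deriv η t = 0 := by
      rw [SolvesLP, and_iff_right (horizontalLP_point _)]
      exact forall₂_congr fun t ht => pair (dΩ t ht) (dη t ht)
    refine ⟨s0.trans s1.symm, s1.trans s2.symm, s2.trans (forall₂_congr fun t ht => ?_)⟩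
    exact (reduced_iff_eulerPoincare I K _ _ _ _ _ _ (hsum t) (eη t ht)).trans
      (pairEP (dΩ t ht) (dΩr t ht)).symm
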